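/- Let $(p_n)_{n\ge 1}$ be a sequence of real numbers with $0\le p_n\le 1$, and suppose that there are $\varepsilon>0$ and $C>0$ such that $p_n\le C(\log n)^{-\varepsilon}$ for all sufficiently large $n$. Build a sequence $P=(P_n)_{n\ge1}$ of random sets $P_n\subseteq[n]=\{1,\dots,n\}$ by putting each $a\in[n]$ in $P_n$ with probability $p_n$, all these choices (over all $n\ge1$ and all $a\in[n]$) being mutually independent. For $\psi:\mathbb{N}\to[0,1/2]$, where $\mathbb{N}=\{1,2,\dots\}$, let \[ W^P(\psi)=\Bigl\{x\in[0,1] : \bigl|x-\tfrac{a}{n}\bigr|<\tfrac{\psi(n)}{n}\text{ for some } a\in P_n, \text{ for infinitely many } n\in\mathbb{N}\Bigr\}, \] and let $\lambda$ denote Lebesgue measure on $\mathbb{R}$. Then for every $\psi:\mathbb{N}\to[0,1/2]$ (not assumed monotonic), almost surely \[ \lambda(W^P(\psi))=\begin{cases}0 & \text{if } \sum_{n=1}^\infty p_n\psi(n)<\infty,\\ 1 & \text{if } \sum_{n=1}^\infty p_n\psi(n)=\infty.\end{cases} \] -/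

import Mathlib

open MeasureTheory ProbabilityTheory Filter

/-- The set `W^P(ψ)` of all `x ∈ [0, 1]` such that `|x - a / n| < ψ n / n` for some `a ∈ P n`,
for infinitely many positive integers `n`. The entries at index `0` are never used. -/
def approxSet (P : ℕ → Set ℕ) (ψ : ℕ → ℝ) : Set ℝ :=
  {x : ℝ | x ∈ Set.Icc (0 : ℝ) 1 ∧
    {n : ℕ | 1 ≤ n ∧ ∃ a ∈ P n, |x - (a : ℝ) / (n : ℝ)| < ψ n / (n : ℝ)}.Infinite}

/-- `P` is a sequence of random sets `P n ⊆ [n] = {1, …, n}`, for `n ≥ 1`, where each `a ∈ [n]` is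
put in `P n` with probability `p n`, all these choices (over all `n` and all `a ∈ [n]`) being
mutually independent. -/
structure IsRandomNumerators {Ω : Type*} [MeasurableSpace Ω] (μ : Measure Ω)
    (p : ℕ → ℝ) (P : ℕ → Ω → Set ℕ) : Prop where
  subset_Icc : ∀ n, 1 ≤ n → ∀ ω, P n ω ⊆ Set.Icc 1 n
  measurableSet_mem : ∀ n, 1 ≤ n → ∀ a ∈ Set.Icc 1 n, MeasurableSet {ω | a ∈ P n ω}
  prob_mem : ∀ n, 1 ≤ n → ∀ a ∈ Set.Icc 1 n, μ {ω | a ∈ P n ω} = ENNReal.ofReal (p n)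
  indep : iIndepSet
    (fun q : {q : ℕ × ℕ // 1 ≤ q.1 ∧ q.2 ∈ Set.Icc 1 q.1} => {ω | q.1.2 ∈ P q.1.1 ω}) μ

-- Randomness can be traded for a deterministic set. Fix `x` in `(0, 1)`. Since `ψ n ≤ 1/2`, only
-- the integer nearest to `n * x` can serve as a numerator for `n`, and it is chosen with
-- probability `p n`, independently over `n`. By the two Borel–Cantelli lemmas, `x` is almost surely
-- approximated infinitely often or almost surely only finitely often, according to whether the sum
-- of `p n` over the `n` with `‖n • x‖ < ψ n` diverges. By Fubini the random set almost surely
-- agrees up to measure zero with `resonantSet`, which must be shown null or of full measure.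
--
-- If `∑ p n * ψ n` converges, the sum defining `resonantSet` has finite integral, so the set is
-- null. If it diverges, two facts are needed.
--
-- Not null: count, with weight `p n`, only the hits at fractions `a / n` with `gcd(n, a) ≤ (log
-- n)^(ε/2)`. These are a positive proportion of all `a`, so the first moment is at least a constant
-- times the partial sum `X`. In the second moment, pairs of distinct fractions contribute `O(X²)`.
-- Pairs representing the same fraction contribute `O(X)`: the pair `(m, b)` is determined by the
-- fraction and `l = gcd(m, b)`, and the gcd cutoff with the decay of `p` gives `p m ≤ C / l²`,
-- which is summable. A second-moment argument then makes the hit count unbounded on a set of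
-- positive measure.
--
-- Zero-one law: for each outcome, Cassels' lemma says that multiplying `ψ` by a constant alters the
-- limsup set only by a null set. Fubini carries this over to `resonantSet`. As doubling a point at
-- most doubles its distance to the integers, the union over `k` of the resonant sets of `2^k * ψ`
-- is mapped into itself by the ergodic doubling map.

-- Chebyshev-type sums over primes.

theorem Nat.sum_log_primeFactors_le (n : ℕ) :
    ∑ p ∈ n.primeFactors, Real.log p ≤ Real.log n := by
  rcases Nat.eq_zero_or_pos n with rfl | hn
  · simp
  rw [← Real.log_prod (fun p hp => by
    exact_mod_cast (Nat.prime_of_mem_primeFactors hp).ne_zero), ← Nat.cast_prod]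
  have h := Nat.le_of_dvd hn (Nat.prod_primeFactors_dvd n)
  have h0 : 0 < ∏ p ∈ n.primeFactors, p :=
    Finset.prod_pos fun p hp => (Nat.prime_of_mem_primeFactors hp).pos
  apply Real.log_le_log
  · exact_mod_cast h0
  · exact_mod_cast h

/-- Double count `∑ log p` over the pairs `p ∣ k ≤ N`: each `k` contributes at most `log N`, while
each `p` occurs `⌊N / p⌋ ≥ N / (2p)` times. -/
theorem Nat.sum_prime_log_div_le (N : ℕ) :
    ∑ p ∈ (Finset.range (N + 1)).filter Nat.Prime, Real.log p / p ≤ 2 * Real.log N := by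
  rcases Nat.eq_zero_or_pos N with rfl | hN
  · rw [Finset.sum_eq_zero]
    · simp
    · intro p hp
      simp only [Finset.mem_filter, Finset.mem_range] at hp
      have := hp.2.pos
      omega
  have hN' : (0 : ℝ) < N := by exact_mod_cast hN
  have h1 : ∑ k ∈ Finset.Ioc 0 N, ∑ p ∈ (Finset.range (N + 1)).filter Nat.Prime,
      (if p ∣ k then Real.log p else 0) ≤ N * Real.log N := by
    calc _ ≤ ∑ k ∈ Finset.Ioc 0 N, Real.log N := by
          apply Finset.sum_le_sum
          intro k hk
          rw [Finset.mem_Ioc] at hk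
          rw [← Finset.sum_filter]
          calc _ = ∑ p ∈ k.primeFactors, Real.log p := by
                apply Finset.sum_congr _ (fun _ _ => rfl)
                ext p
                simp only [Finset.mem_filter, Finset.mem_range, Nat.mem_primeFactors]
                constructor
                · rintro ⟨⟨_, hp⟩, hd⟩
                  exact ⟨hp, hd, by omega⟩
                · rintro ⟨hp, hd, _⟩
                  exact ⟨⟨by have := Nat.le_of_dvd hk.1 hd; omega, hp⟩, hd⟩
            _ ≤ Real.log k := Nat.sum_log_primeFactors_le k
            _ ≤ Real.log N := by
                apply Real.log_le_log
                · exact_mod_cast hk.1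
                · exact_mod_cast hk.2
      _ = N * Real.log N := by simp
  rw [Finset.sum_comm] at h1
  have h2 : ∑ p ∈ (Finset.range (N + 1)).filter Nat.Prime, (N / 2 : ℝ) * (Real.log p / p) ≤
      N * Real.log N := by
    refine le_trans (Finset.sum_le_sum ?_) h1
    intro p hp
    simp only [Finset.mem_filter, Finset.mem_range] at hp
    rw [← Finset.sum_filter, Finset.sum_const, Nat.Ioc_filter_dvd_card_eq_div, nsmul_eq_mul]
    have hp0 : 0 < p := hp.2.pos
    have hp0' : (0 : ℝ) < p := by exact_mod_cast hp0
    have hlog : 0 ≤ Real.log p := Real.log_natCast_nonneg p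
    have hle : N ≤ 2 * p * (N / p) := by
      have e1 := Nat.div_add_mod N p
      have e2 := Nat.mod_lt N hp0
      have e3 : 1 ≤ N / p := Nat.div_pos (by omega) hp0
      nlinarith
    have hle' : (N : ℝ) ≤ 2 * p * ((N / p : ℕ) : ℝ) := by exact_mod_cast hle
    have : (N / 2 : ℝ) / p ≤ ((N / p : ℕ) : ℝ) := by
      rw [div_le_iff₀ hp0']
      linarith
    calc (N / 2 : ℝ) * (Real.log p / p) = (N / 2 : ℝ) / p * Real.log p := by ring
      _ ≤ _ := mul_le_mul_of_nonneg_right this hlog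
  rw [← Finset.mul_sum] at h2
  have h3 : (N : ℝ) * (∑ p ∈ (Finset.range (N + 1)).filter Nat.Prime, Real.log p / p) ≤
      N * (2 * Real.log N) := by linarith
  exact le_of_mul_le_mul_left h3 hN'

theorem Nat.sum_log_div_le_of_le {s : Finset ℕ} {y : ℝ} (hy : 1 ≤ y)
    (hs : ∀ p ∈ s, p.Prime ∧ (p : ℝ) ≤ y) :
    ∑ p ∈ s, Real.log p / p ≤ 2 * Real.log y := by
  have hf : 1 ≤ ⌊y⌋₊ := Nat.le_floor (by exact_mod_cast hy)
  calc ∑ p ∈ s, Real.log p / p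
      ≤ ∑ p ∈ (Finset.range (⌊y⌋₊ + 1)).filter Nat.Prime, Real.log p / p := by
        apply Finset.sum_le_sum_of_subset_of_nonneg
        · intro p hp
          simp only [Finset.mem_filter, Finset.mem_range]
          exact ⟨Nat.lt_succ_of_le (Nat.le_floor (hs p hp).2), (hs p hp).1⟩
        · intro p _ _
          exact div_nonneg (Real.log_natCast_nonneg p) (Nat.cast_nonneg p)
    _ ≤ 2 * Real.log ⌊y⌋₊ := Nat.sum_prime_log_div_le _
    _ ≤ 2 * Real.log y := by
        have := Real.log_le_log (by exact_mod_cast hf) (Nat.floor_le (by linarith : 0 ≤ y))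
        linarith

-- Many residues have a small common factor with the modulus.

/-- An expectation bound: under the weights `∏ x i`, a random subset contains `i` with probability
`x i / (1 + x i) ≤ x i`. Markov's inequality then shows, in the next lemma, that subsets with small
`∑ l i` carry half the total weight. -/
theorem Finset.sum_powerset_prod_mul_sum_le {ι : Type*} [DecidableEq ι] (s : Finset ι)
    (x l : ι → ℝ) (hx : ∀ i ∈ s, 0 ≤ x i) (hl : ∀ i ∈ s, 0 ≤ l i) :
    ∑ t ∈ s.powerset, (∏ i ∈ t, x i) * ∑ i ∈ t, l i ≤
      (∏ i ∈ s, (1 + x i)) * ∑ i ∈ s, x i * l i := by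
  induction s using Finset.induction_on with
  | empty => simp
  | insert a s ha ih =>
    have ih := ih (fun i hi => hx i (Finset.mem_insert_of_mem hi))
      (fun i hi => hl i (Finset.mem_insert_of_mem hi))
    have hxa := hx a (Finset.mem_insert_self _ _)
    have hla := hl a (Finset.mem_insert_self _ _)
    have hT : 0 ≤ ∏ i ∈ s, (1 + x i) :=
      Finset.prod_nonneg fun i hi => by linarith [hx i (Finset.mem_insert_of_mem hi)]
    rw [Finset.sum_powerset_insert ha, Finset.prod_insert ha, Finset.sum_insert ha]
    have e : ∑ t ∈ s.powerset, (∏ i ∈ insert a t, x i) * ∑ i ∈ insert a t, l i =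
        x a * (∑ t ∈ s.powerset, (∏ i ∈ t, x i) * ∑ i ∈ t, l i) +
          x a * l a * ∏ i ∈ s, (1 + x i) := by
      rw [Finset.prod_one_add, Finset.mul_sum, Finset.mul_sum, ← Finset.sum_add_distrib]
      apply Finset.sum_congr rfl
      intro t ht
      have hat : a ∉ t := fun h => ha (Finset.mem_powerset.1 ht h)
      rw [Finset.prod_insert hat, Finset.sum_insert hat]
      ring
    rw [e]
    have h1 : 0 ≤ x a * l a * (x a * ∏ i ∈ s, (1 + x i)) := by positivity
    nlinarith

theorem Finset.prod_one_add_le_two_mul_sum_powerset {ι : Type*} [DecidableEq ι] (s : Finset ι)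
    (x l : ι → ℝ) (hx : ∀ i ∈ s, 0 ≤ x i) (hl : ∀ i ∈ s, 0 ≤ l i) {L : ℝ} (hL : 0 < L)
    (h : 2 * ∑ i ∈ s, x i * l i ≤ L) :
    ∏ i ∈ s, (1 + x i) ≤
      2 * ∑ t ∈ s.powerset with ∑ i ∈ t, l i ≤ L, ∏ i ∈ t, x i := by
  have h1 := Finset.sum_powerset_prod_mul_sum_le s x l hx hl
  have hw : ∀ t ∈ s.powerset, 0 ≤ ∏ i ∈ t, x i := fun t ht =>
    Finset.prod_nonneg fun i hi => hx i (Finset.mem_powerset.1 ht hi)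
  have hT : 0 ≤ ∏ i ∈ s, (1 + x i) := Finset.prod_nonneg fun i hi => by linarith [hx i hi]
  have h2 : L * ∑ t ∈ s.powerset with ¬ ∑ i ∈ t, l i ≤ L, ∏ i ∈ t, x i ≤
      ∑ t ∈ s.powerset, (∏ i ∈ t, x i) * ∑ i ∈ t, l i := by
    rw [Finset.mul_sum, Finset.sum_filter]
    apply Finset.sum_le_sum
    intro t ht
    have hl' : 0 ≤ ∑ i ∈ t, l i :=
      Finset.sum_nonneg fun i hi => hl i (Finset.mem_powerset.1 ht hi)
    rw [ite_not]
    split_ifs with hc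
    · exact mul_nonneg (hw t ht) hl'
    · rw [mul_comm]
      exact mul_le_mul_of_nonneg_left (le_of_not_ge hc) (hw t ht)
  have h3 := Finset.sum_filter_add_sum_filter_not s.powerset (fun t => ∑ i ∈ t, l i ≤ L)
    (fun t => ∏ i ∈ t, x i)
  rw [← Finset.prod_one_add] at h3
  have h4 : L * (2 * ∑ t ∈ s.powerset with ¬ ∑ i ∈ t, l i ≤ L, ∏ i ∈ t, x i) ≤
      L * ∏ i ∈ s, (1 + x i) := by
    nlinarith [mul_le_mul_of_nonneg_left h hT]
  have h5 := le_of_mul_le_mul_left h4 hL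
  linarith

theorem Nat.totient_mul_le (k m : ℕ) : (k * m).totient ≤ k * m.totient := by
  induction k using induction_on_primes with
  | zero => simp
  | one => simp
  | prime_mul p a hp ih =>
    rw [mul_assoc, mul_assoc]
    refine le_trans ?_ (Nat.mul_le_mul_left p ih)
    by_cases hd : p ∣ a * m
    · rw [Nat.totient_mul_of_prime_of_dvd hp hd]
    · rw [Nat.totient_mul_of_prime_of_not_dvd hp hd]
      exact Nat.mul_le_mul_right _ (Nat.sub_le _ _)

theorem Finset.exp_neg_two_mul_sum_le_prod_one_sub {ι : Type*} (s : Finset ι) (x : ι → ℝ)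
    (hx : ∀ i ∈ s, 0 ≤ x i ∧ x i ≤ 1 / 2) :
    Real.exp (-2 * ∑ i ∈ s, x i) ≤ ∏ i ∈ s, (1 - x i) := by
  rw [Finset.mul_sum, Real.exp_sum]
  apply Finset.prod_le_prod
  · intro i _
    exact (Real.exp_pos _).le
  · intro i hi
    obtain ⟨h0, h1⟩ := hx i hi
    have h2 := Real.add_one_le_exp (2 * x i)
    rw [show -2 * x i = -(2 * x i) by ring, Real.exp_neg, inv_le_iff_one_le_mul₀ (Real.exp_pos _)]
    nlinarith

/-- With `z = log n`: for `z^δ < p ≤ z` the Chebyshev bound gives `2 / δ`, and there are at most `z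
/ log 2` prime factors above `z`, each contributing at most `1 / z`. -/
theorem Nat.sum_primeFactors_gt_inv_le {n : ℕ} {δ : ℝ} (hδ : 0 < δ) (hn : 1 < Real.log n) :
    ∑ p ∈ n.primeFactors.filter (fun p : ℕ => ¬ (p : ℝ) ≤ Real.log n ^ δ), (p : ℝ)⁻¹ ≤ 2 / δ + 2 := by
  set z := Real.log n with hz
  have hlz : 0 < Real.log z := Real.log_pos hn
  have hy : 1 < z ^ δ := Real.one_lt_rpow hn hδ
  have hlogy : Real.log (z ^ δ) = δ * Real.log z := Real.log_rpow (by linarith) δ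
  rw [← Finset.sum_filter_add_sum_filter_not _ (fun p : ℕ => (p : ℝ) ≤ z)]
  apply _root_.add_le_add
  · have h1 : ∀ p ∈ (n.primeFactors.filter (fun p : ℕ => ¬ (p : ℝ) ≤ z ^ δ)).filter
        (fun p : ℕ => (p : ℝ) ≤ z), (p : ℝ)⁻¹ ≤ (Real.log p / p) * (δ * Real.log z)⁻¹ := by
      intro p hp
      simp only [Finset.mem_filter, not_le] at hp
      have hp0 : (0 : ℝ) < p := by
        exact_mod_cast (Nat.prime_of_mem_primeFactors hp.1.1).pos
      have : δ * Real.log z ≤ Real.log p := by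
        rw [← hlogy]
        exact Real.log_le_log (by linarith) hp.1.2.le
      have hpos : 0 < δ * Real.log z := by positivity
      rw [div_mul_eq_mul_div, ← div_eq_mul_inv, inv_eq_one_div]
      gcongr
      rwa [le_div_iff₀ hpos, one_mul]
    refine (Finset.sum_le_sum h1).trans ?_
    rw [← Finset.sum_mul]
    have h2 := Nat.sum_log_div_le_of_le (s := (n.primeFactors.filter
      (fun p : ℕ => ¬ (p : ℝ) ≤ z ^ δ)).filter (fun p : ℕ => (p : ℝ) ≤ z)) hn.le (by
        intro p hp
        simp only [Finset.mem_filter] at hp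
        exact ⟨Nat.prime_of_mem_primeFactors hp.1.1, hp.2⟩)
    calc _ ≤ (2 * Real.log z) * (δ * Real.log z)⁻¹ := by gcongr
      _ = 2 / δ := by field_simp
  · have h1 : ∀ p ∈ (n.primeFactors.filter (fun p : ℕ => ¬ (p : ℝ) ≤ z ^ δ)).filter
        (fun p : ℕ => ¬ (p : ℝ) ≤ z), (p : ℝ)⁻¹ ≤ z⁻¹ := by
      intro p hp
      simp only [Finset.mem_filter, not_le] at hp
      exact inv_anti₀ (by linarith) hp.2.le
    refine (Finset.sum_le_card_nsmul _ _ _ h1).trans ?_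
    rw [nsmul_eq_mul]
    have hcard : (((n.primeFactors.filter (fun p : ℕ => ¬ (p : ℝ) ≤ z ^ δ)).filter
        (fun p : ℕ => ¬ (p : ℝ) ≤ z)).card : ℝ) ≤ (n.primeFactors.card : ℝ) := by
      exact_mod_cast Finset.card_le_card
        ((Finset.filter_subset _ _).trans (Finset.filter_subset _ _))
    have h2 : (n.primeFactors.card : ℝ) * Real.log 2 ≤ z := by
      refine le_trans ?_ (Nat.sum_log_primeFactors_le n)
      rw [← nsmul_eq_mul]
      apply Finset.card_nsmul_le_sum
      intro p hp
      exact Real.log_le_log (by norm_num)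
        (by exact_mod_cast (Nat.prime_of_mem_primeFactors hp).two_le)
    have h3 := Real.log_two_gt_d9
    rw [← div_eq_mul_inv, div_le_iff₀ (by linarith)]
    have h0 : (0 : ℝ) ≤ n.primeFactors.card := Nat.cast_nonneg _
    nlinarith

/-- For each squarefree `d = ∏ p ∈ t, p` dividing `n`, exactly `φ(n / d) ≥ φ(n) / d` residues have
gcd `d` with `n`, and different `t` give different `d`. -/
theorem Nat.totient_mul_sum_le_card_gcd {n : ℕ} (hn : 0 < n) (A : Finset (Finset ℕ))
    (hA : ∀ t ∈ A, t ⊆ n.primeFactors) {K : ℝ}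
    (hK : ∀ t ∈ A, ((∏ p ∈ t, p : ℕ) : ℝ) ≤ K) :
    (n.totient : ℝ) * ∑ t ∈ A, ∏ p ∈ t, (p : ℝ)⁻¹ ≤
      ((Finset.range n).filter (fun a => ((n.gcd a : ℕ) : ℝ) ≤ K)).card := by
  have hprime : ∀ t ∈ A, ∀ p ∈ t, p.Prime := fun t ht p hp =>
    Nat.prime_of_mem_primeFactors (hA t ht hp)
  have hsub : A.biUnion (fun t => (Finset.range n).filter (fun a => n.gcd a = ∏ p ∈ t, p)) ⊆
      (Finset.range n).filter (fun a => ((n.gcd a : ℕ) : ℝ) ≤ K) := by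
    intro a ha
    simp only [Finset.mem_biUnion, Finset.mem_filter] at ha ⊢
    obtain ⟨t, ht, har, hg⟩ := ha
    exact ⟨har, by rw [hg]; exact hK t ht⟩
  have hcard := Finset.card_le_card hsub
  rw [Finset.card_biUnion] at hcard
  · refine le_trans ?_ (Nat.cast_le.2 hcard)
    rw [Nat.cast_sum, Finset.mul_sum]
    apply Finset.sum_le_sum
    intro t ht
    have hd : ∏ p ∈ t, p ∣ n :=
      (Finset.prod_dvd_prod_of_subset _ _ _ (hA t ht)).trans (Nat.prod_primeFactors_dvd n)
    rw [← Nat.totient_div_of_dvd hd, Finset.prod_inv_distrib, ← div_eq_mul_inv]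
    have hpos : 0 < ∏ p ∈ t, p := Nat.pos_of_dvd_of_pos hd hn
    have hpos' : (0 : ℝ) < ∏ p ∈ t, (p : ℝ) := by
      rw [← Nat.cast_prod]
      exact_mod_cast hpos
    rw [div_le_iff₀ hpos', ← Nat.cast_prod, mul_comm]
    have := Nat.totient_mul_le (∏ p ∈ t, p) (n / ∏ p ∈ t, p)
    rw [Nat.mul_div_cancel' hd] at this
    exact_mod_cast this
  · intro t ht u hu htu
    rw [Function.onFun, Finset.disjoint_left]
    intro a ha hb
    simp only [Finset.mem_filter] at ha hb
    apply htu
    rw [← Nat.primeFactors_prod (hprime t ht), ← Nat.primeFactors_prod (hprime u hu),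
      ← ha.2, ← hb.2]

/-- A positive proportion of the residues modulo `n` have a small common factor with `n`. -/
theorem Nat.exists_mul_le_card_gcd_le {η : ℝ} (hη : 0 < η) :
    ∃ c : ℝ, 0 < c ∧ ∀ᶠ n : ℕ in atTop,
      c * n ≤ ((Finset.range n).filter
        (fun a => ((n.gcd a : ℕ) : ℝ) ≤ Real.log n ^ η)).card := by
  -- Chosen so that twice the Chebyshev bound `2 * δ * log z` over primes up to `z^δ` equals the
  -- Markov threshold `η * log z`.
  set δ := η / 4 with hδ
  have hδ0 : 0 < δ := by positivity
  have hsum : Summable (fun n : ℕ => ((n : ℝ) ^ 2)⁻¹) :=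
    Real.summable_nat_pow_inv.2 (by norm_num : 1 < 2)
  set B := ∑' n : ℕ, ((n : ℝ) ^ 2)⁻¹ with hB
  refine ⟨Real.exp (-2 * (2 / δ + 2)) * Real.exp (-2 * B) / 2, by positivity, ?_⟩
  have hlog : ∀ᶠ n : ℕ in atTop, 1 < Real.log n :=
    (Real.tendsto_log_atTop.comp tendsto_natCast_atTop_atTop).eventually (eventually_gt_atTop 1)
  filter_upwards [hlog, eventually_gt_atTop 0] with n hn hn0
  set z := Real.log n with hz
  have hz0 : 0 < z := by linarith
  have hlz : 0 < Real.log z := Real.log_pos hn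
  have hlogy : Real.log (z ^ δ) = δ * Real.log z := Real.log_rpow hz0 δ
  set Q := n.primeFactors.filter (fun p : ℕ => (p : ℝ) ≤ z ^ δ) with hQ
  have hQp : ∀ p ∈ Q, p.Prime := fun p hp =>
    Nat.prime_of_mem_primeFactors (Finset.mem_filter.1 hp).1
  have hmarkov := Finset.prod_one_add_le_two_mul_sum_powerset Q (fun p => (p : ℝ)⁻¹)
    (fun p => Real.log p) (fun p _ => by positivity) (fun p _ => Real.log_natCast_nonneg p)
    (L := η * Real.log z) (by positivity) (by
      have := Nat.sum_log_div_le_of_le (s := Q) (Real.one_le_rpow hn.le hδ0.le)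
        (fun p hp => ⟨hQp p hp, (Finset.mem_filter.1 hp).2⟩)
      rw [hlogy] at this
      calc _ = 2 * ∑ p ∈ Q, Real.log p / p := by
            congr 1
            exact Finset.sum_congr rfl fun p _ => by rw [div_eq_mul_inv, mul_comm]
        _ ≤ _ := by rw [hδ] at this; linarith)
  have hcount := Nat.totient_mul_sum_le_card_gcd hn0
    (Q.powerset.filter (fun t => ∑ p ∈ t, Real.log p ≤ η * Real.log z))
    (fun t ht => (Finset.mem_powerset.1 (Finset.mem_filter.1 ht).1).trans
      (Finset.filter_subset _ _)) (K := z ^ η) (by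
      intro t ht
      rw [Finset.mem_filter, Finset.mem_powerset] at ht
      have hne : ∀ p ∈ t, (p : ℝ) ≠ 0 := fun p hp => by
        exact_mod_cast (hQp p (ht.1 hp)).ne_zero
      rw [← Real.log_prod hne, ← Real.log_rpow hz0] at ht
      rw [Nat.cast_prod]
      refine (Real.log_le_log_iff ?_ (by positivity)).1 ht.2
      exact Finset.prod_pos fun p hp => by exact_mod_cast (hQp p (ht.1 hp)).pos)
  refine le_trans ?_ hcount
  have hphi : (n.totient : ℝ) = n * ∏ p ∈ n.primeFactors, (1 - (p : ℝ)⁻¹) := by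
    have := Nat.totient_eq_mul_prod_factors n
    have h := congrArg (fun q : ℚ => (q : ℝ)) this
    simpa using h
  rw [← Finset.prod_filter_mul_prod_filter_not _ (fun p : ℕ => (p : ℝ) ≤ z ^ δ), ← hQ] at hphi
  have hR : Real.exp (-2 * (2 / δ + 2)) ≤
      ∏ p ∈ n.primeFactors.filter (fun p : ℕ => ¬ (p : ℝ) ≤ z ^ δ), (1 - (p : ℝ)⁻¹) := by
    refine le_trans ?_ (Finset.exp_neg_two_mul_sum_le_prod_one_sub _ _ ?_)
    · have := Nat.sum_primeFactors_gt_inv_le hδ0 hn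
      exact Real.exp_le_exp.2 (by linarith)
    · intro p hp
      have h2 : (2 : ℝ) ≤ p := by
        exact_mod_cast (Nat.prime_of_mem_primeFactors (Finset.mem_filter.1 hp).1).two_le
      refine ⟨by positivity, ?_⟩
      rw [one_div]
      exact inv_anti₀ (by norm_num) h2
  -- The divisors built from small primes make up for the loss in `φ(n) / n`: what remains is `∏ (1
  -- - 1/p²)`, bounded below uniformly in `n`.
  have hQ2 : Real.exp (-2 * B) ≤ (∏ p ∈ Q, (1 - (p : ℝ)⁻¹)) * ∏ p ∈ Q, (1 + (p : ℝ)⁻¹) := by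
    rw [← Finset.prod_mul_distrib]
    calc Real.exp (-2 * B) ≤ Real.exp (-2 * ∑ p ∈ Q, ((p : ℝ) ^ 2)⁻¹) := by
          have := hsum.sum_le_tsum Q (fun p _ => by positivity)
          exact Real.exp_le_exp.2 (by linarith)
      _ ≤ ∏ p ∈ Q, (1 - ((p : ℝ) ^ 2)⁻¹) := by
          apply Finset.exp_neg_two_mul_sum_le_prod_one_sub
          intro p hp
          have h2 : (2 : ℝ) ≤ p := by exact_mod_cast (hQp p hp).two_le
          refine ⟨by positivity, ?_⟩
          rw [one_div]
          exact inv_anti₀ (by norm_num) (by nlinarith)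
      _ = _ := Finset.prod_congr rfl fun p _ => by ring
  set S := ∑ t ∈ Q.powerset.filter
    (fun t : Finset ℕ => ∑ p ∈ t, Real.log p ≤ η * Real.log z), ∏ p ∈ t, (p : ℝ)⁻¹
  set U := ∏ p ∈ Q, (1 - (p : ℝ)⁻¹)
  set V := ∏ p ∈ n.primeFactors.filter (fun p : ℕ => ¬ (p : ℝ) ≤ z ^ δ), (1 - (p : ℝ)⁻¹)
  have hU : 0 ≤ U := Finset.prod_nonneg fun p hp => by
    have h2 : (1 : ℝ) ≤ p := by exact_mod_cast (hQp p hp).one_le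
    have := inv_le_one_of_one_le₀ h2
    linarith
  have hV : 0 < V := (Real.exp_pos _).trans_le hR
  have h1 : Real.exp (-2 * B) ≤ U * (2 * S) :=
    hQ2.trans (mul_le_mul_of_nonneg_left hmarkov hU)
  have h2 : Real.exp (-2 * (2 / δ + 2)) * Real.exp (-2 * B) ≤ V * (U * (2 * S)) :=
    mul_le_mul hR h1 (Real.exp_pos _).le hV.le
  rw [hphi]
  calc _ = (Real.exp (-2 * (2 / δ + 2)) * Real.exp (-2 * B)) * (n / 2) := by ring
    _ ≤ (V * (U * (2 * S))) * (n / 2) := by gcongr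
    _ = _ := by ring

-- Overlaps of balls around fractions.

theorem Int.card_filter_ne_zero_abs_lt_le (s : Finset ℤ) {U : ℝ} (hU : 0 ≤ U)
    (hs : ∀ h ∈ s, h ≠ 0 ∧ |(h : ℝ)| < U) : (s.card : ℝ) ≤ 2 * U := by
  have hsub : s ⊆ (Finset.Icc (-(⌊U⌋₊ : ℤ)) ⌊U⌋₊).erase 0 := by
    intro h hh
    obtain ⟨h0, h1⟩ := hs h hh
    rw [Finset.mem_erase, Finset.mem_Icc]
    have h2 : h.natAbs ≤ ⌊U⌋₊ := Nat.le_floor (by rw [Nat.cast_natAbs, Int.cast_abs]; exact h1.le)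
    exact ⟨h0, by omega, by omega⟩
  have hc := Finset.card_le_card hsub
  rw [Finset.card_erase_of_mem (by simp), Int.card_Icc] at hc
  have hc' : s.card ≤ 2 * ⌊U⌋₊ := by omega
  calc (s.card : ℝ) ≤ 2 * (⌊U⌋₊ : ℝ) := by exact_mod_cast hc'
    _ ≤ 2 * U := by linarith [Nat.floor_le hU]

/-- With `g = gcd(n, m)`, the difference is `g` times a nonzero integer of size below `T / g`,
leaving at most `2T / g` values. Each value fixes `x.1` modulo `n / g`, so it is taken at most `g`
times. -/
theorem Nat.card_cross_mul_sub_lt_le {n m : ℕ} (hn : 0 < n) {T : ℝ} (hT : 0 ≤ T) :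
    (((Finset.range n ×ˢ Finset.range m).filter (fun x : ℕ × ℕ =>
      x.1 * m ≠ x.2 * n ∧ |(x.1 : ℝ) * m - x.2 * n| < T)).card : ℝ) ≤ 2 * T := by
  set A := (Finset.range n ×ˢ Finset.range m).filter (fun x : ℕ × ℕ =>
      x.1 * m ≠ x.2 * n ∧ |(x.1 : ℝ) * m - x.2 * n| < T) with hA
  obtain ⟨g, n', m', hg, hcop, hn', hm'⟩ := Nat.exists_coprime' (Nat.gcd_pos_of_pos_left m hn)
  have hn'0 : 0 < n' := Nat.pos_of_mul_pos_right (hn' ▸ hn)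
  have hgR : (0 : ℝ) < g := by exact_mod_cast hg
  let f : ℕ × ℕ → ℤ := fun x => (x.1 : ℤ) * m' - x.2 * n'
  have hf : ∀ x : ℕ × ℕ, ((f x : ℤ) : ℝ) * g = (x.1 : ℝ) * m - x.2 * n := by
    intro x
    simp only [f, hn', hm']
    push_cast
    ring
  have himg : ((A.image f).card : ℝ) ≤ 2 * (T / g) := by
    apply Int.card_filter_ne_zero_abs_lt_le _ (by positivity)
    intro h hh
    rw [Finset.mem_image] at hh
    obtain ⟨x, hx, rfl⟩ := hh
    rw [hA, Finset.mem_filter] at hx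
    constructor
    · intro h0
      apply hx.2.1
      have := hf x
      rw [h0, Int.cast_zero, zero_mul] at this
      have h2 : (x.1 : ℝ) * m = x.2 * n := by linarith
      exact_mod_cast h2
    · rw [lt_div_iff₀ hgR]
      calc |((f x : ℤ) : ℝ)| * g = |((f x : ℤ) : ℝ) * g| := by
            rw [abs_mul, abs_of_pos hgR]
        _ < T := by rw [hf]; exact hx.2.2
  have hfib : ∀ h ∈ A.image f, (A.filter (fun x => f x = h)).card ≤ g := by
    intro h _
    rw [← Finset.card_range g]
    apply Finset.card_le_card_of_injOn (fun x => x.1 / n')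
    · intro x hx
      simp only [Finset.coe_filter, Set.mem_ofPred_eq, hA, Finset.mem_filter, Finset.mem_product,
        Finset.mem_range] at hx
      simp only [Finset.coe_range, Set.mem_Iio]
      have := hx.1.1.1
      rw [Nat.div_lt_iff_lt_mul hn'0]
      rw [hn'] at this
      linarith [mul_comm n' g]
    · intro x hx y hy hxy
      simp only [Finset.coe_filter, Set.mem_ofPred_eq] at hx hy
      have hfxy : f x = f y := hx.2.trans hy.2.symm
      simp only [f] at hfxy
      have hdvd : (n' : ℤ) ∣ (x.1 : ℤ) - y.1 := by
        have hc : IsCoprime (n' : ℤ) (m' : ℤ) := Nat.isCoprime_iff_coprime.2 hcop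
        apply hc.dvd_of_dvd_mul_right
        exact ⟨(x.2 : ℤ) - y.2, by linarith⟩
      have hmod : x.1 % n' = y.1 % n' := by
        have h4 : (x.1 : ℤ) % n' = (y.1 : ℤ) % n' :=
          Int.emod_eq_emod_iff_emod_sub_eq_zero.2 (Int.emod_eq_zero_of_dvd hdvd)
        exact_mod_cast h4
      have h1 : x.1 = y.1 := by
        rw [← Nat.div_add_mod x.1 n', ← Nat.div_add_mod y.1 n', hmod, show x.1 / n' = y.1 / n' from hxy]
      have h2 : x.2 = y.2 := by
        rw [h1] at hfxy
        have : (x.2 : ℤ) * n' = y.2 * n' := by linarith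
        have := mul_right_cancel₀ (by exact_mod_cast hn'0.ne') this
        exact_mod_cast this
      exact Prod.ext h1 h2
  have hcard := Finset.card_le_mul_card_image A g hfib
  calc (A.card : ℝ) ≤ g * (A.image f).card := by exact_mod_cast hcard
    _ ≤ g * (2 * (T / g)) := by gcongr
    _ = 2 * T := by field_simp

theorem Nat.eq_of_mul_eq_mul_of_gcd_eq {m b m' b' : ℕ} (hm : 0 < m) (h : b * m' = b' * m)
    (hg : m.gcd b = m'.gcd b') : m = m' ∧ b = b' := by
  have h1 : (m * m').gcd (b * m') = (m * m').gcd (b' * m) := by rw [h]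
  rw [Nat.gcd_mul_right, mul_comm m m', Nat.gcd_mul_right, hg] at h1
  have hg0 : 0 < m'.gcd b' := hg ▸ Nat.gcd_pos_of_pos_left b hm
  have hmm : m' = m := Nat.eq_of_mul_eq_mul_left hg0 h1
  subst hmm
  exact ⟨rfl, Nat.eq_of_mul_eq_mul_right hm h⟩

/-- The pairs `(m, b)` with `b / m = a / n` are told apart by `gcd(m, b)`, so the bounds `C / gcd²`
are summed over distinct integers. -/
theorem sum_weight_same_fraction_le {p : ℕ → ℝ} {C : ℝ} (hC : 0 ≤ C) (F : Finset ℕ)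
    (G : ℕ → Finset ℕ) (hF : ∀ m ∈ F, 0 < m)
    (hG : ∀ m ∈ F, ∀ b ∈ G m, ((m.gcd b : ℕ) : ℝ) ^ 2 * p m ≤ C) {n : ℕ} (hn : 0 < n) (a : ℕ) :
    ∑ m ∈ F, ∑ b ∈ G m, (if a * m = b * n then p m else 0) ≤
      C * ∑' l : ℕ, ((l : ℝ) ^ 2)⁻¹ := by
  have hsum : Summable (fun n : ℕ => ((n : ℝ) ^ 2)⁻¹) :=
    Real.summable_nat_pow_inv.2 (by norm_num : 1 < 2)
  rw [Finset.sum_sigma', ← Finset.sum_filter]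
  set A := (F.sigma G).filter (fun x => a * x.1 = x.2 * n) with hA
  have hmem : ∀ x ∈ A, x.1 ∈ F ∧ x.2 ∈ G x.1 ∧ a * x.1 = x.2 * n := by
    intro x hx
    rw [hA, Finset.mem_filter, Finset.mem_sigma] at hx
    exact ⟨hx.1.1, hx.1.2, hx.2⟩
  have hinj : Set.InjOn (fun x : (_ : ℕ) × ℕ => x.1.gcd x.2) A := by
    rintro ⟨m, b⟩ hx ⟨m', b'⟩ hy hxy
    obtain ⟨h1, _, h3⟩ := hmem _ hx
    obtain ⟨_, _, h3'⟩ := hmem _ hy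
    dsimp only at h1 h3 h3' hxy
    have : b * m' = b' * m := by
      apply Nat.eq_of_mul_eq_mul_left hn
      calc n * (b * m') = (b * n) * m' := by ring
        _ = (a * m') * m := by rw [← h3]; ring
        _ = n * (b' * m) := by rw [h3']; ring
    obtain ⟨rfl, rfl⟩ := Nat.eq_of_mul_eq_mul_of_gcd_eq (hF m h1) this hxy
    rfl
  calc ∑ x ∈ A, p x.1 ≤ ∑ x ∈ A, C * (((x.1.gcd x.2 : ℕ) : ℝ) ^ 2)⁻¹ := by
        apply Finset.sum_le_sum
        intro x hx
        obtain ⟨h1, h2, _⟩ := hmem x hx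
        have hg : (0 : ℝ) < (x.1.gcd x.2 : ℕ) := by
          exact_mod_cast Nat.gcd_pos_of_pos_left _ (hF _ h1)
        rw [← div_eq_mul_inv, le_div_iff₀ (by positivity), mul_comm]
        exact hG _ h1 _ h2
    _ = C * ∑ l ∈ A.image (fun x : (_ : ℕ) × ℕ => x.1.gcd x.2), ((l : ℝ) ^ 2)⁻¹ := by
        rw [Finset.sum_image hinj, Finset.mul_sum]
    _ ≤ _ := by
        gcongr
        exact hsum.sum_le_tsum _ (fun l _ => by positivity)

theorem measureReal_ball_inter_ball_le (x y : ℝ) {r s : ℝ} (hr : 0 ≤ r) (hs : 0 ≤ s) (A : Set ℝ) :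
    (volume.restrict A).real (Metric.ball x r ∩ Metric.ball y s) ≤
      if |x - y| < r + s then 2 * min r s else 0 := by
  have hle : ∀ B : Set ℝ, volume B ≠ ⊤ → (volume.restrict A).real B ≤ volume.real B := by
    intro B hB
    exact ENNReal.toReal_mono hB (Measure.restrict_apply_le A B)
  split_ifs with h
  · have h1 : (volume.restrict A).real (Metric.ball x r ∩ Metric.ball y s) ≤ 2 * r := by
      calc _ ≤ volume.real (Metric.ball x r ∩ Metric.ball y s) :=
            hle _ (measure_ne_top_of_subset Set.inter_subset_left measure_ball_lt_top.ne)
        _ ≤ volume.real (Metric.ball x r) := measureReal_mono Set.inter_subset_left measure_ball_lt_top.ne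
        _ = 2 * r := by simp [Measure.real, Real.volume_ball, hr]
    have h2 : (volume.restrict A).real (Metric.ball x r ∩ Metric.ball y s) ≤ 2 * s := by
      calc _ ≤ volume.real (Metric.ball x r ∩ Metric.ball y s) :=
            hle _ (measure_ne_top_of_subset Set.inter_subset_left measure_ball_lt_top.ne)
        _ ≤ volume.real (Metric.ball y s) := measureReal_mono Set.inter_subset_right measure_ball_lt_top.ne
        _ = 2 * s := by simp [Measure.real, Real.volume_ball, hs]
    rw [mul_min_of_nonneg _ _ (by norm_num : (0 : ℝ) ≤ 2)]
    exact le_min h1 h2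
  · have : Metric.ball x r ∩ Metric.ball y s = ∅ := by
      rw [← Set.disjoint_iff_inter_eq_empty]
      apply Metric.ball_disjoint_ball
      rw [Real.dist_eq]
      linarith
    simp [this]

theorem sum_measureReal_ball_inter_ball_le {n m : ℕ} (hn : 0 < n) (hm : 0 < m) {s t : ℝ}
    (hs : 0 ≤ s) (ht : 0 ≤ t) {G H : Finset ℕ} (hG : G ⊆ Finset.range n)
    (hH : H ⊆ Finset.range m) (A : Set ℝ) :
    ∑ a ∈ G, ∑ b ∈ H, (volume.restrict A).real
        (Metric.ball ((a : ℝ) / n) (s / n) ∩ Metric.ball ((b : ℝ) / m) (t / m)) ≤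
      2 * (s / n) * (∑ a ∈ G, ∑ b ∈ H, if a * m = b * n then (1 : ℝ) else 0) + 8 * (s * t) := by
  have hn' : (0 : ℝ) < n := by exact_mod_cast hn
  have hm' : (0 : ℝ) < m := by exact_mod_cast hm
  set T := m * s + n * t with hT
  have hT0 : 0 ≤ T := by positivity
  have hmin0 : 0 ≤ 2 * min (s / n) (t / m) := by positivity
  have hpt : ∀ a b : ℕ, (volume.restrict A).real
        (Metric.ball ((a : ℝ) / n) (s / n) ∩ Metric.ball ((b : ℝ) / m) (t / m)) ≤
      2 * (s / n) * (if a * m = b * n then (1 : ℝ) else 0) + 2 * min (s / n) (t / m) *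
        (if a * m ≠ b * n ∧ |(a : ℝ) * m - b * n| < T then (1 : ℝ) else 0) := by
    intro a b
    refine (measureReal_ball_inter_ball_le _ _ (by positivity) (by positivity) A).trans ?_
    have hmin : min (s / n) (t / m) ≤ s / n := min_le_left _ _
    have hsn : 0 ≤ s / n := by positivity
    by_cases h1 : a * m = b * n
    · simp only [h1, if_true, ne_eq, not_true_eq_false, false_and, if_false]
      split_ifs <;> linarith
    · simp only [h1, if_false, ne_eq, not_false_eq_true, true_and, mul_zero, zero_add]
      have hiff : |(a : ℝ) / n - b / m| < s / n + t / m ↔ |(a : ℝ) * m - b * n| < T := by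
        have e1 : (a : ℝ) * m - b * n = ((a : ℝ) / n - b / m) * (n * m) := by field_simp
        have e2 : T = (s / n + t / m) * (n * m) := by rw [hT]; field_simp
        rw [e1, e2, abs_mul, abs_of_pos (by positivity : (0 : ℝ) < n * m)]
        exact (mul_lt_mul_iff_left₀ (by positivity)).symm
      simp only [hiff]
      split_ifs <;> linarith
  refine (Finset.sum_le_sum fun a _ => Finset.sum_le_sum fun b _ => hpt a b).trans ?_
  simp only [Finset.sum_add_distrib, ← Finset.mul_sum]
  have hcount : ∑ a ∈ G, ∑ b ∈ H,
      (if a * m ≠ b * n ∧ |(a : ℝ) * m - b * n| < T then (1 : ℝ) else 0) ≤ 2 * T := by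
    refine le_trans ?_ (Nat.card_cross_mul_sub_lt_le (m := m) hn hT0)
    rw [← Finset.sum_product', ← Finset.sum_filter, Finset.sum_const, nsmul_eq_mul, mul_one]
    exact_mod_cast Finset.card_le_card
      (Finset.filter_subset_filter _ (Finset.product_subset_product hG hH))
  -- Rests on `min u v * (u + v) ≤ 2 * u * v` with `u = s / n` and `v = t / m`.
  have h8 : 2 * min (s / n) (t / m) * (2 * T) ≤ 8 * (s * t) := by
    have e2 : T = (s / n + t / m) * (n * m) := by rw [hT]; field_simp
    have e3 : s * t = (s / n) * (t / m) * (n * m) := by field_simp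
    rw [e2, e3]
    have hu : 0 ≤ s / n := by positivity
    have hv : 0 ≤ t / m := by positivity
    have hnm : (0 : ℝ) < n * m := by positivity
    have : min (s / n) (t / m) * (s / n + t / m) ≤ 2 * ((s / n) * (t / m)) := by
      rcases min_cases (s / n) (t / m) with ⟨h, h'⟩ | ⟨h, h'⟩ <;> rw [h] <;> nlinarith
    nlinarith
  have h9 := mul_le_mul_of_nonneg_left hcount hmin0
  linarith

-- The second-moment method.

/-- A sequence of nonnegative functions with comparable second moment and squared first moment,
with unbounded first moments, cannot be almost everywhere bounded. -/
theorem not_ae_bddAbove_of_second_moment {α : Type*} [MeasurableSpace α] (ν : Measure α)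
    [IsFiniteMeasure ν] (S : ℕ → α → ℝ) (hSm : ∀ N, Measurable (S N))
    (hSi : ∀ N, Integrable (S N) ν)
    (hSi2 : ∀ N, Integrable (fun x => S N x ^ 2) ν) {C : ℝ} (hC : 0 < C)
    (h2 : ∀ᶠ N in atTop, ∫ x, S N x ^ 2 ∂ν ≤ C * (∫ x, S N x ∂ν) ^ 2)
    (hlim : Tendsto (fun N => ∫ x, S N x ∂ν) atTop atTop) :
    ¬ ∀ᵐ x ∂ν, BddAbove (Set.range fun N => S N x) := by
  intro hbdd
  let A : ℕ → Set α := fun M => {x | ∀ N, S N x ≤ M}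
  have hAm : ∀ M, MeasurableSet (A M) := by
    intro M
    simp only [A, Set.ofPred_forall]
    exact MeasurableSet.iInter fun N => measurableSet_le (hSm N) measurable_const
  have hA0 : Tendsto (fun M => ν (A M)ᶜ) atTop (nhds 0) := by
    have hz : ν (⋂ M, (A M)ᶜ) = 0 := by
      refine measure_mono_null ?_ hbdd
      intro x hx hb
      obtain ⟨B, hB⟩ := hb
      obtain ⟨M, hM⟩ := exists_nat_ge B
      exact Set.mem_iInter.1 hx M fun N => (hB ⟨N, rfl⟩).trans hM
    rw [← hz]
    apply tendsto_measure_iInter_atTop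
    · exact fun M => (hAm M).compl.nullMeasurableSet
    · intro M M' h
      apply Set.compl_subset_compl.2
      intro x hx N
      exact (hx N).trans (by exact_mod_cast h)
    · exact ⟨0, measure_ne_top _ _⟩
  have hA0' : Tendsto (fun M => ν.real (A M)ᶜ) atTop (nhds 0) := by
    have := (ENNReal.tendsto_toReal ENNReal.zero_ne_top).comp hA0
    simpa [Measure.real, Function.comp_def] using this
  obtain ⟨M, hM⟩ := (hA0'.eventually (gt_mem_nhds (show 0 < 1 / (4 * C) by positivity))).exists
  obtain ⟨N, hN2, hN1, hNM⟩ := (h2.and ((hlim.eventually_gt_atTop 0).and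
    (hlim.eventually_gt_atTop (2 * (M * ν.real Set.univ))))).exists
  set I := ∫ x, S N x ∂ν with hI
  -- Off `A M`, use `S ≤ t/2 * S² + 1/(2t)`. This `t` makes the second-moment term at most `I / 4`,
  -- and the choice of `M` does the same for the other, forcing `I ≤ 2 * M * ν(univ)`.
  set t := 1 / (2 * C * I) with ht
  have ht0 : 0 < t := by positivity
  have hpt : ∀ x, S N x ≤ M + (t / 2 * S N x ^ 2 + (1 / (2 * t)) *
      (A M)ᶜ.indicator (fun _ => (1 : ℝ)) x) := by
    intro x
    by_cases hx : x ∈ A M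
    · have h3 : S N x ≤ M := hx N
      have : 0 ≤ t / 2 * S N x ^ 2 := by positivity
      simp only [Set.indicator, Set.mem_compl_iff, hx, not_true_eq_false, if_false]
      linarith
    · simp only [Set.indicator, Set.mem_compl_iff, hx, not_false_eq_true, if_true]
      have h4 : t / 2 * S N x ^ 2 + 1 / (2 * t) * 1 - S N x = (t * S N x - 1) ^ 2 / (2 * t) := by
        field_simp
        ring
      have h5 : 0 ≤ (t * S N x - 1) ^ 2 / (2 * t) := by positivity
      have h6 : (0 : ℝ) ≤ M := Nat.cast_nonneg M
      linarith
  have hind : Integrable (fun x => (1 / (2 * t)) * (A M)ᶜ.indicator (fun _ => (1 : ℝ)) x) ν :=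
    ((integrable_const (1 : ℝ)).indicator (hAm M).compl).const_mul _
  have hadd : Integrable (fun x => t / 2 * S N x ^ 2 + (1 / (2 * t)) *
      (A M)ᶜ.indicator (fun _ => (1 : ℝ)) x) ν := ((hSi2 N).const_mul (t / 2)).add hind
  have hint := integral_mono (hSi N) ((integrable_const (M : ℝ)).add hadd) hpt
  have hcalc : ∫ x, (M + (t / 2 * S N x ^ 2 + (1 / (2 * t)) *
      (A M)ᶜ.indicator (fun _ => (1 : ℝ)) x)) ∂ν =
      M * ν.real Set.univ + (t / 2 * ∫ x, S N x ^ 2 ∂ν) + (1 / (2 * t)) * ν.real (A M)ᶜ := by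
    rw [integral_add (integrable_const _) hadd,
      integral_add ((hSi2 N).const_mul (t / 2)) hind, integral_const_mul, integral_const_mul,
      integral_const, integral_indicator_const _ (hAm M).compl]
    simp only [smul_eq_mul]
    ring
  have hint' : I ≤ M * ν.real Set.univ + (t / 2 * ∫ x, S N x ^ 2 ∂ν) +
      (1 / (2 * t)) * ν.real (A M)ᶜ := hcalc ▸ hint
  have e1 : t / 2 * ∫ x, S N x ^ 2 ∂ν ≤ I / 4 := by
    calc _ ≤ t / 2 * (C * I ^ 2) := by gcongr
      _ = I / 4 := by rw [ht]; field_simp; norm_num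
  have e2 : (1 / (2 * t)) * ν.real (A M)ᶜ ≤ I / 4 := by
    calc _ ≤ (1 / (2 * t)) * (1 / (4 * C)) := by gcongr
      _ = I / 4 := by rw [ht]; field_simp
  linarith

/-- The points `y` of the circle for which the sum of the `p n` over all `n` with `‖n • y‖ < ψ n`
diverges. -/
def resonantSet (p ψ : ℕ → ℝ) : Set UnitAddCircle :=
  {y | ∑' n : ℕ, {z : UnitAddCircle | ‖n • z‖ < ψ n}.indicator
    (fun _ => ENNReal.ofReal (p n)) y = ⊤}

theorem measurable_tsum_indicator_norm_nsmul_lt (p ψ : ℕ → ℝ) :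
    Measurable fun y => ∑' n : ℕ, {z : UnitAddCircle | ‖n • z‖ < ψ n}.indicator
      (fun _ => ENNReal.ofReal (p n)) y := by
  refine Measurable.tsum fun n => measurable_const.indicator ?_
  exact (isOpen_lt (by fun_prop) continuous_const).measurableSet

theorem measurableSet_resonantSet (p ψ : ℕ → ℝ) : MeasurableSet (resonantSet p ψ) :=
  measurable_tsum_indicator_norm_nsmul_lt p ψ (measurableSet_singleton _)

theorem UnitAddCircle.norm_nsmul_coe_le (n : ℕ) (x : ℝ) (a : ℤ) :
    ‖n • (x : UnitAddCircle)‖ ≤ |n * x - a| := by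
  rw [← AddCircle.coe_nsmul, UnitAddCircle.norm_eq, nsmul_eq_mul]
  exact round_le _ _

/-- The weighted number of hits of `x` by balls around `a / n`, with `n ∈ F` and `a ∈ G n`. -/
noncomputable def weightedHits (p ψ : ℕ → ℝ) (G : ℕ → Finset ℕ) (F : Finset ℕ) (x : ℝ) : ℝ :=
  ∑ n ∈ F, ∑ a ∈ G n, (Metric.ball ((a : ℝ) / n) (ψ n / n)).indicator (fun _ => p n) x

section weightedHits

variable {p ψ : ℕ → ℝ} {G : ℕ → Finset ℕ} {F : Finset ℕ}

theorem measurable_weightedHits : Measurable (weightedHits p ψ G F) := by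
  unfold weightedHits
  refine Finset.measurable_sum _ fun n _ => Finset.measurable_sum _ fun a _ => ?_
  exact measurable_const.indicator measurableSet_ball

theorem integrable_weightedHits (ν : Measure ℝ) [IsFiniteMeasure ν] :
    Integrable (weightedHits p ψ G F) ν := by
  unfold weightedHits
  refine integrable_finsetSum _ fun n _ => integrable_finsetSum _ fun a _ => ?_
  exact (integrable_const _).indicator measurableSet_ball

/-- The numerators run over `0, …, n - 1`, and the ball around `0` extends to the left; integrating
over `(-1, 1]` keeps every ball whole. -/
theorem integral_weightedHits (hF : ∀ n ∈ F, 0 < n)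
    (hψ : ∀ n ∈ F, 0 ≤ ψ n ∧ ψ n ≤ 1 / 2) (hG : ∀ n ∈ F, G n ⊆ Finset.range n) :
    ∫ x, weightedHits p ψ G F x ∂(volume.restrict (Set.Ioc (-1) 1)) =
      ∑ n ∈ F, p n * (2 * (ψ n / n) * (G n).card) := by
  unfold weightedHits
  rw [integral_finsetSum]
  · refine Finset.sum_congr rfl fun n hn => ?_
    rw [integral_finsetSum]
    · have : ∀ a ∈ G n, ∫ x, (Metric.ball ((a : ℝ) / n) (ψ n / n)).indicator (fun _ => p n) x
          ∂(volume.restrict (Set.Ioc (-1) 1)) = p n * (2 * (ψ n / n)) := by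
        intro a ha
        have hn0 : (0 : ℝ) < n := by exact_mod_cast hF n hn
        have hn1 : (1 : ℝ) ≤ n := by exact_mod_cast hF n hn
        have han : (a : ℝ) + 1 ≤ n := by exact_mod_cast Finset.mem_range.1 (hG n hn ha)
        obtain ⟨h0, h1⟩ := hψ n hn
        rw [integral_indicator_const _ measurableSet_ball, Measure.real,
          Measure.restrict_apply measurableSet_ball, Set.inter_eq_left.2, Real.volume_ball,
          ENNReal.toReal_ofReal (by positivity), smul_eq_mul, mul_comm]
        rw [Real.ball_eq_Ioo]
        have hr : ψ n / n ≤ 1 / 2 := by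
          rw [div_le_iff₀ hn0]
          linarith
        have e1 : (0 : ℝ) ≤ (a : ℝ) / n := by positivity
        have e2 : (a : ℝ) / n + ψ n / n ≤ 1 := by
          rw [← add_div, div_le_one hn0]
          linarith
        intro x hx
        exact ⟨by linarith [hx.1], by linarith [hx.2]⟩
      rw [Finset.sum_congr rfl this, Finset.sum_const, nsmul_eq_mul]
      ring
    · intro a _
      exact (integrable_const _).indicator measurableSet_ball
  · intro n _
    refine integrable_finsetSum _ fun a _ => ?_
    exact (integrable_const _).indicator measurableSet_ball

theorem weightedHits_sq (x : ℝ) : weightedHits p ψ G F x ^ 2 =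
    ∑ n ∈ F, ∑ m ∈ F, ∑ a ∈ G n, ∑ b ∈ G m,
      (Metric.ball ((a : ℝ) / n) (ψ n / n) ∩ Metric.ball ((b : ℝ) / m) (ψ m / m)).indicator
        (fun _ => p n * p m) x := by
  rw [weightedHits, sq, Finset.sum_mul_sum]
  refine Finset.sum_congr rfl fun n _ => Finset.sum_congr rfl fun m _ => ?_
  rw [Finset.sum_mul_sum]
  refine Finset.sum_congr rfl fun a _ => Finset.sum_congr rfl fun b _ => ?_
  rw [Set.inter_indicator_mul]

theorem integrable_weightedHits_sq (ν : Measure ℝ) [IsFiniteMeasure ν] :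
    Integrable (fun x => weightedHits p ψ G F x ^ 2) ν := by
  simp only [weightedHits_sq]
  refine integrable_finsetSum _ fun n _ => integrable_finsetSum _ fun m _ =>
    integrable_finsetSum _ fun a _ => integrable_finsetSum _ fun b _ => ?_
  exact (integrable_const _).indicator (measurableSet_ball.inter measurableSet_ball)

theorem integral_weightedHits_sq (A : Set ℝ) [IsFiniteMeasure (volume.restrict A)] :
    ∫ x, weightedHits p ψ G F x ^ 2 ∂(volume.restrict A) =
    ∑ n ∈ F, ∑ m ∈ F, p n * p m * ∑ a ∈ G n, ∑ b ∈ G m, (volume.restrict A).real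
      (Metric.ball ((a : ℝ) / n) (ψ n / n) ∩ Metric.ball ((b : ℝ) / m) (ψ m / m)) := by
  have hi : ∀ n m a b : ℕ, Integrable ((Metric.ball ((a : ℝ) / n) (ψ n / n) ∩
      Metric.ball ((b : ℝ) / m) (ψ m / m)).indicator (fun _ => p n * p m))
      (volume.restrict A) := fun n m a b =>
    (integrable_const _).indicator (measurableSet_ball.inter measurableSet_ball)
  simp only [weightedHits_sq]
  rw [integral_finsetSum _ fun n _ => integrable_finsetSum _ fun m _ =>
    integrable_finsetSum _ fun a _ => integrable_finsetSum _ fun b _ => hi n m a b]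
  refine Finset.sum_congr rfl fun n _ => ?_
  rw [integral_finsetSum _ fun m _ =>
    integrable_finsetSum _ fun a _ => integrable_finsetSum _ fun b _ => hi n m a b]
  refine Finset.sum_congr rfl fun m _ => ?_
  rw [integral_finsetSum _ fun a _ => integrable_finsetSum _ fun b _ => hi n m a b,
    Finset.mul_sum]
  refine Finset.sum_congr rfl fun a _ => ?_
  rw [integral_finsetSum _ fun b _ => hi n m a b, Finset.mul_sum]
  refine Finset.sum_congr rfl fun b _ => ?_
  rw [integral_indicator_const _ (measurableSet_ball.inter measurableSet_ball), smul_eq_mul,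
    mul_comm]

theorem integral_weightedHits_sq_le {C : ℝ} (hC : 0 ≤ C) (hF : ∀ n ∈ F, 0 < n)
    (hp : ∀ n ∈ F, 0 ≤ p n) (hψ : ∀ n ∈ F, 0 ≤ ψ n) (hG : ∀ n ∈ F, G n ⊆ Finset.range n)
    (hgcd : ∀ m ∈ F, ∀ b ∈ G m, ((m.gcd b : ℕ) : ℝ) ^ 2 * p m ≤ C)
    (A : Set ℝ) [IsFiniteMeasure (volume.restrict A)] :
    ∫ x, weightedHits p ψ G F x ^ 2 ∂(volume.restrict A) ≤
      2 * (C * ∑' l : ℕ, ((l : ℝ) ^ 2)⁻¹) * (∑ n ∈ F, p n * ψ n) +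
        8 * (∑ n ∈ F, p n * ψ n) ^ 2 := by
  rw [integral_weightedHits_sq]
  set B := C * ∑' l : ℕ, ((l : ℝ) ^ 2)⁻¹ with hB
  have hB0 : 0 ≤ B := mul_nonneg hC (tsum_nonneg fun l => by positivity)
  have h1 : ∀ n ∈ F, ∑ m ∈ F, p n * p m * ∑ a ∈ G n, ∑ b ∈ G m, (volume.restrict A).real
      (Metric.ball ((a : ℝ) / n) (ψ n / n) ∩ Metric.ball ((b : ℝ) / m) (ψ m / m)) ≤
      2 * B * (p n * ψ n) + 8 * (p n * ψ n) * ∑ m ∈ F, p m * ψ m := by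
    intro n hn
    have hn0 : (0 : ℝ) < n := by exact_mod_cast hF n hn
    have hpn := hp n hn
    have hψn := hψ n hn
    have h2 : ∀ m ∈ F, p n * p m * ∑ a ∈ G n, ∑ b ∈ G m, (volume.restrict A).real
        (Metric.ball ((a : ℝ) / n) (ψ n / n) ∩ Metric.ball ((b : ℝ) / m) (ψ m / m)) ≤
        2 * (ψ n / n) * p n * (∑ a ∈ G n, ∑ b ∈ G m, if a * m = b * n then p m else 0) +
          8 * (p n * ψ n) * (p m * ψ m) := by
      intro m hm
      have h3 := mul_le_mul_of_nonneg_left (sum_measureReal_ball_inter_ball_le (hF n hn) (hF m hm)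
        hψn (hψ m hm) (hG n hn) (hG m hm) A) (mul_nonneg hpn (hp m hm))
      refine h3.trans (le_of_eq ?_)
      have h4 : ∑ a ∈ G n, ∑ b ∈ G m, (if a * m = b * n then p m else 0) =
          p m * ∑ a ∈ G n, ∑ b ∈ G m, (if a * m = b * n then (1 : ℝ) else 0) := by
        simp only [Finset.mul_sum, mul_ite, mul_one, mul_zero]
      rw [h4]
      ring
    refine (Finset.sum_le_sum h2).trans ?_
    rw [Finset.sum_add_distrib, ← Finset.mul_sum, ← Finset.mul_sum, Finset.sum_comm]
    have h5 : ∑ a ∈ G n, ∑ m ∈ F, ∑ b ∈ G m, (if a * m = b * n then p m else 0) ≤ n * B := by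
      calc _ ≤ ∑ a ∈ G n, B := Finset.sum_le_sum fun a _ =>
            sum_weight_same_fraction_le hC F G hF hgcd (hF n hn) a
        _ = (G n).card * B := by simp
        _ ≤ n * B := by
            have := Finset.card_le_card (hG n hn)
            rw [Finset.card_range] at this
            gcongr
    have h6 : 2 * (ψ n / n) * p n *
        (∑ a ∈ G n, ∑ m ∈ F, ∑ b ∈ G m, (if a * m = b * n then p m else 0)) ≤
        2 * B * (p n * ψ n) := by
      calc _ ≤ 2 * (ψ n / n) * p n * (n * B) := by gcongr
        _ = _ := by field_simp
    linarith
  refine (Finset.sum_le_sum h1).trans (le_of_eq ?_)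
  rw [Finset.sum_add_distrib, ← Finset.mul_sum, ← Finset.sum_mul, ← Finset.mul_sum]
  ring

/-- For each `n` the balls are disjoint because `ψ n ≤ 1/2`, so `p n` is counted at most once. -/
theorem ofReal_weightedHits_le (hF : ∀ n ∈ F, 0 < n) (hp : ∀ n ∈ F, 0 ≤ p n)
    (hψ : ∀ n ∈ F, ψ n ≤ 1 / 2) (x : ℝ) :
    ENNReal.ofReal (weightedHits p ψ G F x) ≤
      ∑' n : ℕ, {z : UnitAddCircle | ‖n • z‖ < ψ n}.indicator
        (fun _ => ENNReal.ofReal (p n)) (x : UnitAddCircle) := by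
  have hnn : ∀ n ∈ F, ∀ a ∈ G n,
      0 ≤ (Metric.ball ((a : ℝ) / n) (ψ n / n)).indicator (fun _ => p n) x :=
    fun n hn a _ => Set.indicator_nonneg (fun _ _ => hp n hn) x
  rw [weightedHits, ENNReal.ofReal_sum_of_nonneg fun n hn => Finset.sum_nonneg (hnn n hn)]
  refine le_trans (Finset.sum_le_sum fun n hn => ?_) (ENNReal.sum_le_tsum F)
  have hn0 : (0 : ℝ) < n := by exact_mod_cast hF n hn
  have hmem : ∀ a : ℕ, x ∈ Metric.ball ((a : ℝ) / n) (ψ n / n) → |n * x - a| < ψ n := by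
    intro a ha
    rw [Metric.mem_ball, Real.dist_eq, lt_div_iff₀ hn0] at ha
    calc |n * x - a| = |x - a / n| * n := by
          rw [← abs_of_pos hn0, ← abs_mul, abs_of_pos hn0]
          congr 1
          field_simp
      _ < ψ n := ha
  by_cases hx : ∃ a ∈ G n, x ∈ Metric.ball ((a : ℝ) / n) (ψ n / n)
  · obtain ⟨a, ha, hxa⟩ := hx
    have hlt := hmem a hxa
    rw [Finset.sum_eq_single_of_mem a ha, Set.indicator_of_mem hxa, Set.indicator_of_mem]
    · exact (UnitAddCircle.norm_nsmul_coe_le n x a).trans_lt (by exact_mod_cast hlt)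
    · intro b _ hba
      apply Set.indicator_of_notMem
      intro hxb
      have hlt' := hmem b hxb
      have h2 := hψ n hn
      rw [abs_lt] at hlt hlt'
      apply hba
      have e1 : (b : ℝ) < a + 1 := by linarith
      have e2 : (a : ℝ) < b + 1 := by linarith
      have e1' : b < a + 1 := by exact_mod_cast e1
      have e2' : a < b + 1 := by exact_mod_cast e2
      omega
  · push Not at hx
    rw [Finset.sum_eq_zero fun a ha => Set.indicator_of_notMem (hx a ha) _]
    simp

end weightedHits

/-- If `∑ p n * ψ n` diverges and `p n` decays like a power of `log n`, then the resonant set does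
not have measure zero. -/
theorem not_ae_notMem_resonantSet {p ψ : ℕ → ℝ} (hp : ∀ n, 1 ≤ n → 0 ≤ p n)
    {ε C : ℝ} (hε : 0 < ε) (hC : 0 < C)
    (hdecay : ∀ᶠ n : ℕ in atTop, p n ≤ C * Real.log n ^ (-ε))
    (hψ : ∀ n, 1 ≤ n → ψ n ∈ Set.Icc (0 : ℝ) (1 / 2))
    (hdiv : ¬ Summable fun n : ℕ => p n * ψ n) :
    ¬ ∀ᵐ x : ℝ ∂(volume.restrict (Set.Ioc (-1 : ℝ) 1)), (x : UnitAddCircle) ∉ resonantSet p ψ := by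
  obtain ⟨c, hc, hcard⟩ := Nat.exists_mul_le_card_gcd_le (half_pos hε)
  have hlog : ∀ᶠ n : ℕ in atTop, 1 < Real.log n :=
    (Real.tendsto_log_atTop.comp tendsto_natCast_atTop_atTop).eventually (eventually_gt_atTop 1)
  obtain ⟨n₀, hn₀⟩ := eventually_atTop.1
    (hcard.and (hdecay.and (hlog.and (eventually_ge_atTop 1))))
  -- The exponent `ε / 2` is what makes the squared gcd cancel the decay `(log n)^(-ε)` of `p n`.
  let G : ℕ → Finset ℕ := fun n =>
    (Finset.range n).filter (fun a => ((n.gcd a : ℕ) : ℝ) ≤ Real.log n ^ (ε / 2))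
  let F : ℕ → Finset ℕ := fun N => Finset.Ico n₀ N
  have hF : ∀ N, ∀ n ∈ F N, n₀ ≤ n := fun N n hn => (Finset.mem_Ico.1 hn).1
  have hF1 : ∀ N, ∀ n ∈ F N, 1 ≤ n := fun N n hn => (hn₀ n (hF N n hn)).2.2.2
  have hG : ∀ n, G n ⊆ Finset.range n := fun n => Finset.filter_subset _ _
  have hgcd : ∀ N, ∀ m ∈ F N, ∀ b ∈ G m, ((m.gcd b : ℕ) : ℝ) ^ 2 * p m ≤ C := by
    intro N m hm b hb
    obtain ⟨-, h2, h3, h4⟩ := hn₀ m (hF N m hm)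
    have h5 := (Finset.mem_filter.1 hb).2
    have h0 : 0 < Real.log m := by linarith
    calc ((m.gcd b : ℕ) : ℝ) ^ 2 * p m
        ≤ (Real.log m ^ (ε / 2)) ^ 2 * (C * Real.log m ^ (-ε)) := by
          gcongr
          exact hp m h4
      _ = C * ((Real.log m ^ (ε / 2)) ^ (2 : ℕ) * Real.log m ^ (-ε)) := by ring
      _ = C := by
          rw [← Real.rpow_natCast, ← Real.rpow_mul h0.le, ← Real.rpow_add h0]
          norm_num
  set X : ℕ → ℝ := fun N => ∑ n ∈ F N, p n * ψ n with hX
  have hterm : ∀ n, n₀ ≤ n → 0 ≤ p n * ψ n := fun n hn =>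
    mul_nonneg (hp n (hn₀ n hn).2.2.2) (hψ n (hn₀ n hn).2.2.2).1
  have hXlim : Tendsto X atTop atTop := by
    have h1 : ¬ Summable fun n : ℕ => p (n + n₀) * ψ (n + n₀) := fun h =>
      hdiv ((summable_nat_add_iff n₀).1 h)
    have h2 := (not_summable_iff_tendsto_nat_atTop_of_nonneg
      (fun n => hterm (n + n₀) (Nat.le_add_left _ _))).1 h1
    rw [← tendsto_add_atTop_iff_nat n₀]
    refine h2.congr fun N => ?_
    simp only [hX, F]
    rw [Finset.sum_Ico_eq_sum_range, Nat.add_sub_cancel]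
    exact Finset.sum_congr rfl fun n _ => by rw [add_comm]
  set I : ℕ → ℝ := fun N =>
    ∫ x, weightedHits p ψ G (F N) x ∂(volume.restrict (Set.Ioc (-1 : ℝ) 1)) with hI
  have hIX : ∀ N, 2 * c * X N ≤ I N := by
    intro N
    simp only [hI, hX]
    rw [integral_weightedHits (hF1 N) (fun n hn => hψ n (hF1 N n hn)) (fun n _ => hG n),
      Finset.mul_sum]
    apply Finset.sum_le_sum
    intro n hn
    have h1 : c * n ≤ (G n).card := (hn₀ n (hF N n hn)).1
    have hn0 : (0 : ℝ) < n := by exact_mod_cast hF1 N n hn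
    have h2 : 0 ≤ p n * (2 * (ψ n / n)) :=
      mul_nonneg (hp n (hF1 N n hn)) (by have := (hψ n (hF1 N n hn)).1; positivity)
    calc 2 * c * (p n * ψ n) = p n * (2 * (ψ n / n)) * (c * n) := by field_simp
      _ ≤ p n * (2 * (ψ n / n)) * (G n).card := by gcongr
      _ = _ := by ring
  set B := C * ∑' l : ℕ, ((l : ℝ) ^ 2)⁻¹ with hB
  have hB0 : 0 ≤ B := mul_nonneg hC.le (tsum_nonneg fun l => by positivity)
  have hX0 : ∀ N, 0 ≤ X N := fun N => Finset.sum_nonneg fun n hn => hterm n (hF N n hn)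
  have hunb := not_ae_bddAbove_of_second_moment (volume.restrict (Set.Ioc (-1 : ℝ) 1))
    (fun N => weightedHits p ψ G (F N)) (fun N => measurable_weightedHits)
    (fun N => integrable_weightedHits _)
    (fun N => integrable_weightedHits_sq _) (C := (2 * B + 8) / (2 * c) ^ 2) (by positivity)
    (by
      filter_upwards [hXlim.eventually_ge_atTop 1] with N hN
      refine (integral_weightedHits_sq_le hC.le (hF1 N) (fun n hn => hp n (hF1 N n hn))
        (fun n hn => (hψ n (hF1 N n hn)).1) (fun n _ => hG n) (hgcd N) _).trans ?_
      have h1 : (2 * c * X N) ^ 2 ≤ I N ^ 2 := by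
        have := hX0 N
        exact pow_le_pow_left₀ (by positivity) (hIX N) 2
      -- Once `X N ≥ 1`, the same-fraction contribution, linear in `X N`, is absorbed by the
      -- quadratic one.
      have h2 : X N ≤ X N ^ 2 := by nlinarith
      calc 2 * B * X N + 8 * X N ^ 2 ≤ 2 * B * X N ^ 2 + 8 * X N ^ 2 := by gcongr
        _ = (2 * B + 8) / (2 * c) ^ 2 * (2 * c * X N) ^ 2 := by field_simp
        _ ≤ (2 * B + 8) / (2 * c) ^ 2 * I N ^ 2 := by gcongr)
    (tendsto_atTop_mono hIX (hXlim.const_mul_atTop (by positivity)))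
  intro hae
  apply hunb
  filter_upwards [hae] with x hx
  refine ⟨(∑' n : ℕ, {z : UnitAddCircle | ‖n • z‖ < ψ n}.indicator
    (fun _ => ENNReal.ofReal (p n)) (x : UnitAddCircle)).toReal, ?_⟩
  rintro _ ⟨N, rfl⟩
  exact (ENNReal.ofReal_le_iff_le_toReal hx).1 (ofReal_weightedHits_le (hF1 N)
    (fun n hn => hp n (hF1 N n hn)) (fun n hn => (hψ n (hF1 N n hn)).2) x)

-- Borel–Cantelli for random numerators and the zero-one law.

theorem UnitAddCircle.norm_nsmul_coe (n : ℕ) (x : ℝ) :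
    ‖n • (x : UnitAddCircle)‖ = |n * x - round (n * x)| := by
  rw [← AddCircle.coe_nsmul, UnitAddCircle.norm_eq, nsmul_eq_mul]

theorem UnitAddCircle.ae_restrict_Ioc_coe_iff {q : UnitAddCircle → Prop}
    (hq : MeasurableSet {y | q y}) (t : ℝ) :
    (∀ᵐ x : ℝ ∂(volume.restrict (Set.Ioc t (t + 1))), q (x : UnitAddCircle)) ↔ ∀ᵐ y, q y := by
  have h := UnitAddCircle.measurePreserving_mk t
  rw [← h.map_eq, ae_map_iff h.measurable.aemeasurable hq]

theorem UnitAddCircle.ae_restrict_Icc_coe_iff {q : UnitAddCircle → Prop}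
    (hq : MeasurableSet {y | q y}) :
    (∀ᵐ x : ℝ ∂(volume.restrict (Set.Icc 0 1)), q (x : UnitAddCircle)) ↔ ∀ᵐ y, q y := by
  have h := UnitAddCircle.ae_restrict_Ioc_coe_iff hq 0
  rwa [zero_add, restrict_Ioc_eq_restrict_Icc] at h

/-- Lets the second Borel–Cantelli lemma run over all of `ℕ` when only the indices in `J` matter. -/
theorem ProbabilityTheory.iIndepSet.ite_empty {Ω ι : Type*} [MeasurableSpace Ω] {μ : Measure Ω}
    {B : ι → Set Ω} (hB : iIndepSet B μ) (hBm : ∀ i, MeasurableSet (B i)) (J : Set ι)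
    [DecidablePred (· ∈ J)] : iIndepSet (fun i => if i ∈ J then B i else ∅) μ := by
  have hm : ∀ i, MeasurableSet (if i ∈ J then B i else ∅) := fun i => by
    split_ifs
    · exact hBm i
    · exact MeasurableSet.empty
  rw [iIndepSet_iff_meas_biInter hm]
  intro s
  by_cases hs : ∀ i ∈ s, i ∈ J
  · rw [Finset.prod_congr rfl fun i hi => by rw [if_pos (hs i hi)],
      Set.iInter₂_congr fun i hi => if_pos (hs i hi)]
    exact hB.meas_biInter s
  · push Not at hs
    obtain ⟨i, hi, hiJ⟩ := hs
    rw [Finset.prod_eq_zero hi (by rw [if_neg hiJ, measure_empty])]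
    refine measure_mono_null (Set.biInter_subset_of_mem hi) ?_
    rw [if_neg hiJ, measure_empty]

section RandomNumerators

variable {Ω : Type*} [MeasurableSpace Ω] {μ : Measure Ω} {p ψ : ℕ → ℝ} {P : ℕ → Ω → Set ℕ}

theorem IsRandomNumerators.measurableSet_infinite (hP : IsRandomNumerators μ p P) (ψ : ℕ → ℝ) :
    MeasurableSet {z : ℝ × Ω | {n : ℕ | 1 ≤ n ∧ ∃ a ∈ P n z.2,
      |z.1 - (a : ℝ) / (n : ℝ)| < ψ n / (n : ℝ)}.Infinite} := by
  have he : {z : ℝ × Ω | {n : ℕ | 1 ≤ n ∧ ∃ a ∈ P n z.2,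
      |z.1 - (a : ℝ) / (n : ℝ)| < ψ n / (n : ℝ)}.Infinite} =
      limsup (fun n : ℕ => {z : ℝ × Ω | 1 ≤ n ∧ ∃ a ∈ P n z.2,
        |z.1 - (a : ℝ) / (n : ℝ)| < ψ n / (n : ℝ)}) atTop := by
    ext z
    rw [mem_limsup_iff_frequently_mem]
    exact Nat.frequently_atTop_iff_infinite.symm
  rw [he]
  refine MeasurableSet.measurableSet_limsup fun n => ?_
  by_cases hn : 1 ≤ n
  · have : {z : ℝ × Ω | 1 ≤ n ∧ ∃ a ∈ P n z.2, |z.1 - (a : ℝ) / (n : ℝ)| < ψ n / (n : ℝ)} =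
        ⋃ a ∈ Set.Icc 1 n, {z : ℝ × Ω | |z.1 - (a : ℝ) / (n : ℝ)| < ψ n / (n : ℝ)} ∩
          Prod.snd ⁻¹' {ω | a ∈ P n ω} := by
      ext z
      simp only [Set.mem_ofPred_eq, Set.mem_iUnion, Set.mem_inter_iff, Set.mem_preimage]
      constructor
      · rintro ⟨-, a, ha, h⟩
        exact ⟨a, hP.subset_Icc n hn _ ha, h, ha⟩
      · rintro ⟨a, -, h, ha⟩
        exact ⟨hn, a, ha, h⟩
    rw [this]
    refine MeasurableSet.biUnion (Set.to_countable _) fun a ha => ?_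
    refine MeasurableSet.inter ?_ (measurable_snd (hP.measurableSet_mem n hn a ha))
    exact measurableSet_lt (by fun_prop) measurable_const
  · simp [hn]

theorem IsRandomNumerators.ae_infinite_of_mem_resonantSet [IsProbabilityMeasure μ]
    (hP : IsRandomNumerators μ p P) {x : ℝ} (hx : x ∈ Set.Ioo (0 : ℝ) 1)
    (hres : (x : UnitAddCircle) ∈ resonantSet p ψ) :
    ∀ᵐ ω ∂μ, {n : ℕ | 1 ≤ n ∧ ∃ a ∈ P n ω,
      |x - (a : ℝ) / (n : ℝ)| < ψ n / (n : ℝ)}.Infinite := by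
  classical
  -- The nearest integer, clamped to the allowed numerators. As `0 < x < 1`, the clamping has no
  -- effect for large `n`.
  let c : ℕ → ℕ := fun n => max 1 (min (n + 1) (round (((n + 1 : ℕ) : ℝ) * x)).toNat)
  have hc : ∀ n, c n ∈ Set.Icc 1 (n + 1) := fun n => ⟨le_max_left _ _, by simp [c]⟩
  let J : Set ℕ := {n | ‖(n + 1) • (x : UnitAddCircle)‖ < ψ (n + 1)}
  let B : ℕ → Set Ω := fun n => {ω | c n ∈ P (n + 1) ω}
  have hBm : ∀ n, MeasurableSet (B n) := fun n =>
    hP.measurableSet_mem (n + 1) (Nat.le_add_left 1 n) (c n) (hc n)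
  have hB : iIndepSet B μ := hP.indep.precomp
    (g := fun n : ℕ => (⟨(n + 1, c n), Nat.le_add_left 1 n, hc n⟩ :
      {q : ℕ × ℕ // 1 ≤ q.1 ∧ q.2 ∈ Set.Icc 1 q.1}))
    (fun n m h => by simpa using congrArg (fun q => q.1.1) h)
  have hs := hB.ite_empty hBm J
  have hsm : ∀ n, MeasurableSet (if n ∈ J then B n else ∅) := fun n => by
    split_ifs
    · exact hBm n
    · exact MeasurableSet.empty
  have hsum : ∑' n, μ (if n ∈ J then B n else ∅) = ⊤ := by
    have h1 : ∑' n : ℕ, {z : UnitAddCircle | ‖n • z‖ < ψ n}.indicator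
      (fun _ => ENNReal.ofReal (p n)) (x : UnitAddCircle) = ⊤ := hres
    -- The unused index `0` contributes one finite term, so the divergence comes from positive `n`.
    rw [tsum_eq_zero_add' ENNReal.summable, ENNReal.add_eq_top] at h1
    have h2 := h1.resolve_left (by
      rw [Set.indicator_apply]
      split_ifs <;> simp)
    rw [← h2]
    refine tsum_congr fun n => ?_
    rw [Set.indicator_apply]
    change _ = if n ∈ J then _ else _
    by_cases hn : n ∈ J
    · rw [if_pos hn, if_pos hn]
      exact hP.prob_mem (n + 1) (Nat.le_add_left 1 n) (c n) (hc n)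
    · rw [if_neg hn, if_neg hn, measure_empty]
  have hlim := measure_limsup_eq_one hsm hs hsum
  rw [← mem_ae_iff_prob_eq_one (MeasurableSet.measurableSet_limsup hsm)] at hlim
  have hlarge : ∀ᶠ n : ℕ in atTop, 1 ≤ ((n + 1 : ℕ) : ℝ) * x ∧ 1 ≤ ((n + 1 : ℕ) : ℝ) * (1 - x) := by
    have ht : Tendsto (fun n : ℕ => ((n + 1 : ℕ) : ℝ)) atTop atTop :=
      tendsto_natCast_atTop_atTop.comp (tendsto_add_atTop_nat 1)
    exact ((ht.atTop_mul_const hx.1).eventually_ge_atTop 1).and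
      ((ht.atTop_mul_const (sub_pos.2 hx.2)).eventually_ge_atTop 1)
  filter_upwards [hlim] with ω hω
  rw [mem_limsup_iff_frequently_mem] at hω
  rw [← Nat.frequently_atTop_iff_infinite]
  refine (tendsto_add_atTop_nat 1).frequently ((hω.and_eventually hlarge).mono ?_)
  rintro n ⟨hn, h1, h2⟩
  by_cases hJ : n ∈ J
  swap
  · rw [if_neg hJ] at hn
    exact hn.elim
  rw [if_pos hJ] at hn
  refine ⟨Nat.le_add_left 1 n, c n, hn, ?_⟩
  have hn0 : (0 : ℝ) < ((n + 1 : ℕ) : ℝ) := by positivity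
  have hr := abs_le.1 (abs_sub_round (((n + 1 : ℕ) : ℝ) * x))
  have hr1 : 0 < round (((n + 1 : ℕ) : ℝ) * x) := by
    have : (0 : ℝ) < round (((n + 1 : ℕ) : ℝ) * x) := by linarith
    exact_mod_cast this
  have hr2 : round (((n + 1 : ℕ) : ℝ) * x) < ((n + 1 : ℕ) : ℤ) := by
    have : (round (((n + 1 : ℕ) : ℝ) * x) : ℝ) < ((n + 1 : ℕ) : ℝ) := by linarith
    exact_mod_cast this
  have hcr : (c n : ℤ) = round (((n + 1 : ℕ) : ℝ) * x) := by
    simp only [c]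
    omega
  have hcr' : (c n : ℝ) = round (((n + 1 : ℕ) : ℝ) * x) := by exact_mod_cast hcr
  have hJ' : ‖(n + 1) • (x : UnitAddCircle)‖ < ψ (n + 1) := hJ
  rw [UnitAddCircle.norm_nsmul_coe, ← hcr'] at hJ'
  rw [lt_div_iff₀ hn0]
  calc |x - (c n : ℝ) / ((n + 1 : ℕ) : ℝ)| * ((n + 1 : ℕ) : ℝ)
      = |(x - (c n : ℝ) / ((n + 1 : ℕ) : ℝ)) * ((n + 1 : ℕ) : ℝ)| := by
        rw [abs_mul, abs_of_pos hn0]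
    _ = |((n + 1 : ℕ) : ℝ) * x - c n| := by
        congr 1
        field_simp
    _ < ψ (n + 1) := hJ'

/-- First Borel–Cantelli: because `ψ n ≤ 1/2`, a hit forces `a` to be the integer nearest to `n *
x`, so the event has probability at most `p n`, and is empty unless `‖n • x‖ < ψ n`. -/
theorem IsRandomNumerators.ae_finite_of_notMem_resonantSet
    (hP : IsRandomNumerators μ p P) (hψ : ∀ n, 1 ≤ n → ψ n ≤ 1 / 2) {x : ℝ}
    (hres : (x : UnitAddCircle) ∉ resonantSet p ψ) :
    ∀ᵐ ω ∂μ, {n : ℕ | 1 ≤ n ∧ ∃ a ∈ P n ω,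
      |x - (a : ℝ) / (n : ℝ)| < ψ n / (n : ℝ)}.Finite := by
  refine ae_finite_setOfPred_mem (s := fun n : ℕ => {ω | 1 ≤ n ∧ ∃ a ∈ P n ω,
      |x - (a : ℝ) / (n : ℝ)| < ψ n / (n : ℝ)}) (ne_top_of_le_ne_top hres ?_)
  refine ENNReal.tsum_le_tsum fun n => ?_
  by_cases hn : 1 ≤ n
  swap
  · simp [hn]
  have hn0 : (0 : ℝ) < n := by exact_mod_cast hn
  have key : ∀ ω, ∀ a ∈ P n ω, |x - (a : ℝ) / (n : ℝ)| < ψ n / (n : ℝ) →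
      ‖n • (x : UnitAddCircle)‖ < ψ n ∧ a = (round ((n : ℝ) * x)).toNat := by
    intro ω a _ h
    have h1 : |(n : ℝ) * x - a| < ψ n := by
      rw [lt_div_iff₀ hn0] at h
      calc |(n : ℝ) * x - a| = |(x - a / n) * n| := by
            congr 1
            field_simp
        _ = |x - a / n| * n := by rw [abs_mul, abs_of_pos hn0]
        _ < ψ n := h
    refine ⟨(UnitAddCircle.norm_nsmul_coe_le n x a).trans_lt (by exact_mod_cast h1), ?_⟩
    have h2 := abs_le.1 (abs_sub_round ((n : ℝ) * x))
    have h3 := abs_lt.1 (h1.trans_le (hψ n hn))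
    have e1 : (round ((n : ℝ) * x) : ℝ) < (a : ℤ) + 1 := by push_cast; linarith
    have e2 : ((a : ℤ) : ℝ) < round ((n : ℝ) * x) + 1 := by push_cast; linarith
    have e1' : round ((n : ℝ) * x) < (a : ℤ) + 1 := by exact_mod_cast e1
    have e2' : (a : ℤ) < round ((n : ℝ) * x) + 1 := by exact_mod_cast e2
    omega
  rw [Set.indicator_apply]
  set r := (round ((n : ℝ) * x)).toNat
  split_ifs with hJ
  · by_cases hr : r ∈ Set.Icc 1 n
    · rw [← hP.prob_mem n hn r hr]
      refine measure_mono ?_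
      rintro ω ⟨-, a, ha, h⟩
      exact (key ω a ha h).2 ▸ ha
    · refine le_of_eq_of_le ?_ zero_le
      convert measure_empty (μ := μ)
      ext ω
      simp only [Set.mem_ofPred_eq, Set.mem_empty_iff_false, iff_false]
      rintro ⟨-, a, ha, h⟩
      exact hr ((key ω a ha h).2 ▸ hP.subset_Icc n hn ω ha)
  · refine le_of_eq ?_
    convert measure_empty (μ := μ)
    ext ω
    simp only [Set.mem_ofPred_eq, Set.mem_empty_iff_false, iff_false]
    rintro ⟨-, a, ha, h⟩
    exact hJ (key ω a ha h).1

/-- Cassels' lemma for a fixed choice of numerators; it applies because the radii `ψ n / n` tend to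
zero. -/
theorem ae_infinite_of_infinite_const_mul (Q : ℕ → Set ℕ)
    (hψ : ∀ n, 1 ≤ n → ψ n ∈ Set.Icc (0 : ℝ) (1 / 2)) {M : ℝ} (hM : 0 < M) :
    ∀ᵐ x : ℝ, {n : ℕ | 1 ≤ n ∧ ∃ a ∈ Q n, |x - (a : ℝ) / (n : ℝ)| < M * ψ n / (n : ℝ)}.Infinite →
      {n : ℕ | 1 ≤ n ∧ ∃ a ∈ Q n, |x - (a : ℝ) / (n : ℝ)| < ψ n / (n : ℝ)}.Infinite := by
  have hr : Tendsto (fun n : ℕ => ψ n / n) atTop (nhds 0) := by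
    refine squeeze_zero' (g := fun n : ℕ => (1 / 2 : ℝ) / n) ?_ ?_
      (tendsto_const_div_atTop_nhds_zero_nat _)
    · filter_upwards [eventually_ge_atTop 1] with n hn
      have := (hψ n hn).1
      positivity
    · filter_upwards [eventually_ge_atTop 1] with n hn
      have := (hψ n hn).2
      gcongr
  have h := blimsup_thickening_mul_ae_eq (volume : Measure ℝ) (fun n => 1 ≤ n)
    (fun n : ℕ => (fun a : ℕ => (a : ℝ) / n) '' Q n) hM (fun n : ℕ => ψ n / n) hr
  filter_upwards [h.mem_iff] with x hx
  simp only [Metric.mem_thickening_iff, Set.exists_mem_image, Real.dist_eq,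
    ← Nat.cofinite_eq_atTop, cofinite.blimsup_set_eq, Set.mem_ofPred_eq] at hx
  intro hinf
  apply hx.1
  simpa only [mul_div_assoc] using hinf

/-- At a point resonant for `M * ψ` but not for `ψ`, almost every outcome would have infinitely many
hits at the larger radius and finitely many at the smaller. Cassels' lemma and Fubini exclude this
for almost every point. The bound `1/2` is needed for `ψ` only, so `M` may be large. -/
theorem IsRandomNumerators.ae_mem_resonantSet_of_const_mul [IsProbabilityMeasure μ]
    (hP : IsRandomNumerators μ p P) (hψ : ∀ n, 1 ≤ n → ψ n ∈ Set.Icc (0 : ℝ) (1 / 2))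
    {M : ℝ} (hM : 0 < M) :
    ∀ᵐ y : UnitAddCircle, y ∈ resonantSet p (fun n => M * ψ n) → y ∈ resonantSet p ψ := by
  have hmeas : MeasurableSet
      {y | y ∈ resonantSet p (fun n => M * ψ n) → y ∈ resonantSet p ψ} :=
    (measurableSet_resonantSet _ _).imp (measurableSet_resonantSet _ _)
  rw [← UnitAddCircle.ae_restrict_Icc_coe_iff hmeas, ← restrict_Ioo_eq_restrict_Icc]
  have h1 : ∀ᵐ x ∂(volume.restrict (Set.Ioo (0 : ℝ) 1)), ∀ᵐ ω ∂μ,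
      {n : ℕ | 1 ≤ n ∧ ∃ a ∈ P n ω, |x - (a : ℝ) / (n : ℝ)| < M * ψ n / (n : ℝ)}.Infinite →
      {n : ℕ | 1 ≤ n ∧ ∃ a ∈ P n ω, |x - (a : ℝ) / (n : ℝ)| < ψ n / (n : ℝ)}.Infinite := by
    rw [Measure.ae_ae_comm]
    · exact Eventually.of_forall fun ω =>
        ae_restrict_of_ae (ae_infinite_of_infinite_const_mul (fun n => P n ω) hψ hM)
    · exact (hP.measurableSet_infinite fun n => M * ψ n).imp (hP.measurableSet_infinite ψ)
  filter_upwards [h1, ae_restrict_mem measurableSet_Ioo] with x hx hx01 hmem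
  by_contra hnot
  have h2 := hP.ae_infinite_of_mem_resonantSet hx01 hmem
  have h3 := hP.ae_finite_of_notMem_resonantSet (fun n hn => (hψ n hn).2) hnot
  obtain ⟨ω, h4, h5, h6⟩ := (hx.and (h2.and h3)).exists
  exact h4 h5 h6

theorem nsmul_two_mem_resonantSet {y : UnitAddCircle} (h : y ∈ resonantSet p ψ) :
    2 • y ∈ resonantSet p (fun n => 2 * ψ n) := by
  refine top_le_iff.1 (le_of_eq_of_le (Eq.symm h) (ENNReal.tsum_le_tsum fun n => ?_))
  rw [Set.indicator_apply, Set.indicator_apply]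
  split_ifs with h1 h2
  · exact le_rfl
  · exfalso
    apply h2
    have h3 : ‖n • y‖ < ψ n := h1
    calc ‖n • 2 • y‖ = ‖2 • n • y‖ := by rw [smul_comm]
      _ ≤ 2 * ‖n • y‖ := by simpa using norm_nsmul_le (n := 2) (a := n • y)
      _ < 2 * ψ n := by linarith
  · exact zero_le
  · exact zero_le

theorem IsRandomNumerators.ae_notMem_or_ae_mem_resonantSet [IsProbabilityMeasure μ]
    (hP : IsRandomNumerators μ p P) (hψ : ∀ n, 1 ≤ n → ψ n ∈ Set.Icc (0 : ℝ) (1 / 2)) :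
    (∀ᵐ y, y ∉ resonantSet p ψ) ∨ ∀ᵐ y, y ∈ resonantSet p ψ := by
  let D : ℕ → Set UnitAddCircle := fun k => resonantSet p (fun n => 2 ^ k * ψ n)
  have hD0 : D 0 = resonantSet p ψ := by simp [D]
  have hDm : MeasurableSet (⋃ k, D k) :=
    MeasurableSet.iUnion fun k => measurableSet_resonantSet _ _
  have hsub : ∀ᵐ y, y ∈ ⋃ k, D k → y ∈ resonantSet p ψ := by
    have := ae_all_iff.2 fun k : ℕ =>
      hP.ae_mem_resonantSet_of_const_mul hψ (M := 2 ^ k) (by positivity)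
    filter_upwards [this] with y hy hmem
    obtain ⟨k, hk⟩ := Set.mem_iUnion.1 hmem
    exact hy k hk
  have hinv : (⋃ k, D k) ⊆ (fun y : UnitAddCircle => 2 • y) ⁻¹' ⋃ k, D k := by
    intro y hy
    obtain ⟨k, hk⟩ := Set.mem_iUnion.1 hy
    refine Set.mem_iUnion.2 ⟨k + 1, ?_⟩
    have := nsmul_two_mem_resonantSet hk
    simpa only [D, pow_succ', mul_assoc] using this
  -- Inclusion in the preimage suffices: in a finite measure space the two sets have equal measure,
  -- so they agree almost everywhere.
  rcases (AddCircle.ergodic_nsmul (T := 1) one_lt_two).ae_empty_or_univ_of_ae_le_preimage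
    hDm.nullMeasurableSet (LE.le.eventuallyLE hinv) with h | h
  · left
    filter_upwards [h.mem_iff] with y hy hmem
    exact hy.1 (Set.mem_iUnion.2 ⟨0, hD0 ▸ hmem⟩)
  · right
    filter_upwards [h.mem_iff, hsub] with y hy hy2
    exact hy2 (hy.2 trivial)

end RandomNumerators

-- The convergence case and the conclusion.

theorem volume_norm_nsmul_lt_le {n : ℕ} (hn : 1 ≤ n) (r : ℝ) :
    volume {z : UnitAddCircle | ‖n • z‖ < r} ≤ ENNReal.ofReal (2 * r) := by
  have hmp : MeasurePreserving (fun z : UnitAddCircle => n • z) volume volume := by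
    have := Measure.measurePreserving_zsmul (volume : Measure UnitAddCircle) (n := (n : ℤ)) (by omega)
    simpa only [natCast_zsmul] using this
  have he : {z : UnitAddCircle | ‖n • z‖ < r} =
      (fun z : UnitAddCircle => n • z) ⁻¹' Metric.ball 0 r := by
    ext z
    simp
  rw [he, hmp.measure_preimage measurableSet_ball.nullMeasurableSet]
  calc volume (Metric.ball (0 : UnitAddCircle) r)
      ≤ volume (Metric.closedBall (0 : UnitAddCircle) r) := measure_mono Metric.ball_subset_closedBall
    _ = ENNReal.ofReal (min 1 (2 * r)) := AddCircle.volume_closedBall 1 r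
    _ ≤ ENNReal.ofReal (2 * r) := ENNReal.ofReal_le_ofReal (min_le_right _ _)

theorem ae_notMem_resonantSet_of_summable {p ψ : ℕ → ℝ} (hp : ∀ n, 1 ≤ n → 0 ≤ p n)
    (hsum : Summable fun n : ℕ => p n * ψ n) :
    ∀ᵐ y, y ∉ resonantSet p ψ := by
  have hm : ∀ n : ℕ, MeasurableSet {z : UnitAddCircle | ‖n • z‖ < ψ n} := fun n =>
    (isOpen_lt (by fun_prop) continuous_const).measurableSet
  have hint : ∫⁻ y, ∑' n : ℕ, {z : UnitAddCircle | ‖n • z‖ < ψ n}.indicator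
      (fun _ => ENNReal.ofReal (p n)) y ≠ ⊤ := by
    rw [lintegral_tsum fun n => (measurable_const.indicator (hm n)).aemeasurable,
      tsum_eq_zero_add' ENNReal.summable, ENNReal.add_ne_top]
    constructor
    · rw [lintegral_indicator_const (hm 0)]
      exact ENNReal.mul_ne_top ENNReal.ofReal_ne_top (measure_ne_top _ _)
    · have hs : Summable fun n : ℕ => 2 * (p (n + 1) * ψ (n + 1)) :=
        ((summable_nat_add_iff 1).2 hsum).mul_left 2
      refine ne_top_of_le_ne_top hs.tsum_ofReal_ne_top (ENNReal.tsum_le_tsum fun n => ?_)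
      rw [lintegral_indicator_const (hm (n + 1))]
      have h1 : 1 ≤ n + 1 := Nat.le_add_left 1 n
      calc _ ≤ ENNReal.ofReal (p (n + 1)) * ENNReal.ofReal (2 * ψ (n + 1)) := by
            gcongr
            exact volume_norm_nsmul_lt_le h1 _
        _ = ENNReal.ofReal (2 * (p (n + 1) * ψ (n + 1))) := by
            rw [← ENNReal.ofReal_mul (hp _ h1)]
            congr 1
            ring
  filter_upwards [ae_lt_top (measurable_tsum_indicator_norm_nsmul_lt p ψ) hint] with y hy
  exact hy.ne

theorem theorem1 {Ω : Type*} [MeasurableSpace Ω] (μ : Measure Ω) [IsProbabilityMeasure μ]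
    (p : ℕ → ℝ) (hp : ∀ n, 1 ≤ n → p n ∈ Set.Icc (0 : ℝ) 1)
    (hdecay : ∃ ε : ℝ, 0 < ε ∧ ∃ C : ℝ, 0 < C ∧
      ∀ᶠ n : ℕ in atTop, p n ≤ C * Real.log (n : ℝ) ^ (-ε))
    (P : ℕ → Ω → Set ℕ) (hP : IsRandomNumerators μ p P)
    (ψ : ℕ → ℝ) (hψ : ∀ n, 1 ≤ n → ψ n ∈ Set.Icc (0 : ℝ) (1 / 2)) :
    ((Summable fun n : ℕ => p n * ψ n) →
      ∀ᵐ ω ∂μ, volume (approxSet (fun n => P n ω) ψ) = 0) ∧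
    ((¬ Summable fun n : ℕ => p n * ψ n) →
      ∀ᵐ ω ∂μ, volume (approxSet (fun n => P n ω) ψ) = 1) := by
  have hrestrict : ∀ ω, volume (approxSet (fun n => P n ω) ψ) =
      volume.restrict (Set.Icc 0 1) (approxSet (fun n => P n ω) ψ) := fun ω =>
    (Measure.restrict_eq_self _ fun x hx => hx.1).symm
  have hmeas := measurableSet_resonantSet p ψ
  refine ⟨fun hsum => ?_, fun hdiv => ?_⟩
  · have h1 := (UnitAddCircle.ae_restrict_Icc_coe_iff hmeas.compl).2
      (ae_notMem_resonantSet_of_summable (fun n hn => (hp n hn).1) hsum)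
    have h2 : ∀ᵐ x ∂(volume.restrict (Set.Icc (0 : ℝ) 1)), ∀ᵐ ω ∂μ,
        ¬ {n : ℕ | 1 ≤ n ∧ ∃ a ∈ P n ω, |x - (a : ℝ) / (n : ℝ)| < ψ n / (n : ℝ)}.Infinite := by
      filter_upwards [h1] with x hx
      filter_upwards [hP.ae_finite_of_notMem_resonantSet (fun n hn => (hψ n hn).2) hx] with ω hω
      exact fun h => h hω
    rw [Measure.ae_ae_comm (hP.measurableSet_infinite ψ).compl] at h2
    filter_upwards [h2] with ω hω
    rw [hrestrict]
    exact measure_mono_null (fun x hx => not_not.2 hx.2) hω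
  · obtain ⟨ε, hε, C, hC, hdecay⟩ := hdecay
    have hpos := not_ae_notMem_resonantSet (fun n hn => (hp n hn).1) hε hC hdecay hψ hdiv
    have hres : ∀ᵐ y, y ∈ resonantSet p ψ := by
      refine (hP.ae_notMem_or_ae_mem_resonantSet hψ).resolve_left fun hnull => hpos ?_
      -- The interval `(-1, 1]` covers the circle twice, so a null set of the circle lifts to a null
      -- set on each half.
      rw [← Set.Ioc_union_Ioc_eq_Ioc (by norm_num : (-1 : ℝ) ≤ 0) zero_le_one,
        ae_restrict_union_iff]
      have h1 := (UnitAddCircle.ae_restrict_Ioc_coe_iff hmeas.compl (-1)).2 hnull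
      have h2 := (UnitAddCircle.ae_restrict_Ioc_coe_iff hmeas.compl 0).2 hnull
      rw [neg_add_cancel] at h1
      rw [zero_add] at h2
      exact ⟨h1, h2⟩
    have h1 := (UnitAddCircle.ae_restrict_Icc_coe_iff hmeas).2 hres
    have h2 : ∀ᵐ x ∂(volume.restrict (Set.Icc (0 : ℝ) 1)), ∀ᵐ ω ∂μ,
        {n : ℕ | 1 ≤ n ∧ ∃ a ∈ P n ω, |x - (a : ℝ) / (n : ℝ)| < ψ n / (n : ℝ)}.Infinite := by
      rw [← restrict_Ioo_eq_restrict_Icc] at h1 ⊢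
      filter_upwards [h1, ae_restrict_mem measurableSet_Ioo] with x hx hx01
      exact hP.ae_infinite_of_mem_resonantSet hx01 hx
    rw [Measure.ae_ae_comm (hP.measurableSet_infinite ψ)] at h2
    filter_upwards [h2] with ω hω
    have h3 : approxSet (fun n => P n ω) ψ =ᵐ[volume.restrict (Set.Icc 0 1)] Set.univ := by
      rw [eventuallyEq_univ]
      filter_upwards [hω, ae_restrict_mem measurableSet_Icc] with x hx hx01
      exact ⟨hx01, hx⟩
    rw [hrestrict, measure_congr h3, Measure.restrict_apply_univ, Real.volume_Icc]
    simp
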